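/- Fix $\alpha<\tfrac12$. For $\nu\in\mathbb C$ and $x>0$ let $$\boldsymbol W_{\alpha,\nu}(x)=2^{\alpha}x^{2\alpha}e^{\frac1{4x^2}}\,W_{\alpha,\nu}\Bigl(\frac1{2x^2}\Bigr),\qquad \boldsymbol W_{\alpha,\nu}(0)=1,$$ where $W_{\alpha,\nu}$ is the Whittaker function of the second kind, and put $\Delta_\lambda=\sqrt{(\frac12-\alpha)^2-\lambda}$ and $\mathrm m(x)=x^{1-4\alpha}e^{-\frac1{2x^2}}$. The index Whittaker transform of a finite positive Borel measure $\mu$ on $[0,\infty)$ is $\widehat\mu(\lambda)=\int_{[0,\infty)}\boldsymbol W_{\alpha,\Delta_\lambda}(x)\,\mu(dx)$ for $\lambda\ge 0$. For $x,y,\xi>0$ let $$q(x,y,\xi)=(2\pi)^{-\frac12}(xy\xi)^{-1+2\alpha}\exp\Bigl(\frac1{2x^2}+\frac1{2y^2}+\frac1{2\xi^2}-\Bigl(\frac{x^2+y^2+\xi^2}{4xy\xi}\Bigr)^{2}\Bigr)D_{2\alpha}\Bigl(\frac{x^2+y^2+\xi^2}{2xy\xi}\Bigr),$$ where $D_{2\alpha}$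 is the parabolic cylinder function, and let the index Whittaker translation be $(\mathcal T^yf)(x)=\int_0^\infty f(\xi)\,q(x,y,\xi)\,\mathrm m(\xi)\,d\xi$ for $x,y>0$, with $(\mathcal T^xf)(0)=(\mathcal T^0f)(x)=f(x)$ for $x\ge0$. The index Whittaker convolution $\mu*\nu$ of two measures is the measure determined by $$\int_{[0,\infty)}f\,d(\mu*\nu)=\int_{[0,\infty)}\int_{[0,\infty)}(\mathcal T^yf)(x)\,\mu(dx)\,\nu(dy)\qquad\text{for all } f\in \mathrm C_{\mathrm b}[0,\infty).\tag{$*$}$$ (1) For all finite positive Borel measures $\mu_1,\mu_2$ on $[0,\infty)$, the identity $(*)$ determines a unique finite positive Borel measure $\mu_1*\mu_2$. If $\mu,\mu_1,\mu_2$ are finite positive Borel measures on $[0,\infty)$, then $\mu=\mu_1*\mu_2$ if and only if $\widehat\mu(\lambda)=\widehat{\mu_1}(\lambda)\,\widehat{\mu_2}(\lambda)$ for all $\lambda\ge0$. The convolution of finite positive measures is commutative and associative. (2) For all complex Borel measures $\mu_1,\mu_2$ on $[0,\infty)$, the identity $(*)$ (with complex-valued $f\in\mathrm C_{\mathrm b}[0,\infty)$)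 determines a unique complex Borel measure $\mu_1*\mu_2$ on $[0,\infty)$, and with this product the complex vector space $\mathcal M_{\mathbb C}[0,\infty)$ of all complex Borel measures on $[0,\infty)$ is a commutative associative algebra over $\mathbb C$ (that is, $*$ is $\mathbb C$-bilinear, commutative and associative) with identity element the Dirac measure $\delta_0$. -/

import Mathlib

open MeasureTheory
open scoped NNReal BoundedContinuousFunction

noncomputable section

namespace IndexWhittaker

/-- The Tricomi confluent hypergeometric function
`Ψ(a, b; z) = Γ(a)⁻¹ ∫₀^∞ e^{-zt} t^{a-1} (1+t)^{b-a-1} dt`, for `Re a > 0` and `z > 0`. -/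
def tricomi (a b : ℂ) (z : ℝ) : ℂ :=
  (Complex.Gamma a)⁻¹ *
    ∫ t in Set.Ioi (0 : ℝ), (Real.exp (-z * t) : ℂ) * (t : ℂ) ^ (a - 1) *
      ((1 + t : ℝ) : ℂ) ^ (b - a - 1)

/-- The Whittaker function of the second kind
`W_{κ,ν}(z) = e^{-z/2} z^{1/2+ν} Ψ(1/2+ν-κ, 1+2ν; z)`, for real `κ < 1/2`, `ν ∈ ℂ` and `z > 0`.
It is even in `ν`, so that the formula is only used for `Re ν ≥ 0`, where the first parameter of
`Ψ` has positive real part. -/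
def whittakerW (κ : ℝ) (ν : ℂ) (z : ℝ) : ℂ :=
  let ν' : ℂ := if 0 ≤ ν.re then ν else -ν
  (Real.exp (-z / 2) : ℂ) * (z : ℂ) ^ (1 / 2 + ν') * tricomi (1 / 2 + ν' - κ) (1 + 2 * ν') z

/-- The normalized Whittaker function `𝑾_{α,ν}(x) = 2^α x^{2α} e^{1/(4x²)} W_{α,ν}(1/(2x²))`
for `x > 0`, extended by `𝑾_{α,ν}(0) = 1`. -/
def boldW (α : ℝ) (ν : ℂ) (x : ℝ≥0) : ℂ :=
  if x = 0 then 1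
  else (((2 : ℝ) ^ α * (x : ℝ) ^ (2 * α) * Real.exp (1 / (4 * (x : ℝ) ^ 2)) : ℝ) : ℂ) *
    whittakerW α ν (1 / (2 * (x : ℝ) ^ 2))

/-- `Δ_λ = √((1/2 - α)² - λ)` (principal square root). -/
def Delta (α l : ℝ) : ℂ := (((1 / 2 - α) ^ 2 - l : ℝ) : ℂ) ^ (1 / 2 : ℂ)

/-- The index Whittaker transform `μ̂(λ) = ∫_{[0,∞)} 𝑾_{α,Δ_λ}(x) μ(dx)` of a finite measure. -/
def transform (α : ℝ) (μ : FiniteMeasure ℝ≥0) (l : ℝ) : ℂ :=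
  ∫ x, boldW α (Delta α l) x ∂(μ : Measure ℝ≥0)

/-- The weight `m(x) = x^{1-4α} e^{-1/(2x²)}`. -/
def weight (α x : ℝ) : ℝ := x ^ (1 - 4 * α) * Real.exp (-(1 / (2 * x ^ 2)))

/-- The parabolic cylinder function
`D_p(z) = 2^{(p-1)/2} e^{-z²/4} z Ψ((1-p)/2, 3/2; z²/2)` for real `p < 1` and `z > 0`, where `Ψ` is
written out by its integral representation. -/
def parabolicD (p z : ℝ) : ℝ :=
  (2 : ℝ) ^ ((p - 1) / 2) * Real.exp (-(z ^ 2 / 4)) * z * (Real.Gamma ((1 - p) / 2))⁻¹ *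
    ∫ t in Set.Ioi (0 : ℝ), Real.exp (-(z ^ 2 / 2) * t) * t ^ ((1 - p) / 2 - 1) *
      (1 + t) ^ (p / 2)

/-- The kernel `q(x, y, ξ)` of the index Whittaker translation (`x, y, ξ > 0`). -/
def kernelQ (α x y ξ : ℝ) : ℝ :=
  (2 * Real.pi) ^ (-(1 / 2) : ℝ) * (x * y * ξ) ^ (-1 + 2 * α) *
    Real.exp (1 / (2 * x ^ 2) + 1 / (2 * y ^ 2) + 1 / (2 * ξ ^ 2)
      - ((x ^ 2 + y ^ 2 + ξ ^ 2) / (4 * x * y * ξ)) ^ 2) *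
    parabolicD (2 * α) ((x ^ 2 + y ^ 2 + ξ ^ 2) / (2 * x * y * ξ))

/-- The index Whittaker translation `(𝒯^y f)(x) = ∫₀^∞ f(ξ) q(x,y,ξ) m(ξ) dξ` for `x, y > 0`, with
`(𝒯^x f)(0) = (𝒯^0 f)(x) = f(x)`. -/
def translation {E : Type*} [NormedAddCommGroup E] [NormedSpace ℝ E]
    (α : ℝ) (y : ℝ≥0) (f : ℝ≥0 → E) (x : ℝ≥0) : E :=
  if x = 0 then f y
  else if y = 0 then f x
  else ∫ ξ in Set.Ioi (0 : ℝ), (kernelQ α x y ξ * weight α ξ) • f ξ.toNNReal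

/-- `ρ` is an index Whittaker convolution of the finite measures `μ` and `ν`:
`∫ f dρ = ∫∫ (𝒯^y f)(x) μ(dx) ν(dy)` for all `f ∈ C_b[0,∞)`. -/
def IsConv (α : ℝ) (μ ν ρ : FiniteMeasure ℝ≥0) : Prop :=
  ∀ f : ℝ≥0 →ᵇ ℝ, ∫ x, f x ∂(ρ : Measure ℝ≥0) =
    ∫ y, ∫ x, translation α y f x ∂(μ : Measure ℝ≥0) ∂(ν : Measure ℝ≥0)

open scoped Classical in
/-- The index Whittaker convolution `μ * ν` of finite measures: the finite measure `ρ` determined by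
`IsConv α μ ν ρ`. -/
def conv (α : ℝ) (μ ν : FiniteMeasure ℝ≥0) : FiniteMeasure ℝ≥0 :=
  if h : ∃ ρ, IsConv α μ ν ρ then h.choose else 0

/-- The integral `∫ f dμ` of a complex function against a complex measure. -/
def cIntegral (μ : ComplexMeasure ℝ≥0) (f : ℝ≥0 → ℂ) : ℂ :=
  μ.integral f (ContinuousLinearMap.mul ℝ ℂ)

/-- `ρ` is an index Whittaker convolution of the complex measures `μ` and `ν`:
`∫ f dρ = ∫∫ (𝒯^y f)(x) μ(dx) ν(dy)` for all `f ∈ C_b[0,∞)`. -/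
def IsComplexConv (α : ℝ) (μ ν ρ : ComplexMeasure ℝ≥0) : Prop :=
  ∀ f : ℝ≥0 →ᵇ ℂ, cIntegral ρ f =
    cIntegral ν (fun y => cIntegral μ (fun x => translation α y f x))

open scoped Classical in
/-- The index Whittaker convolution `μ * ν` of complex measures: the complex measure `ρ` determined
by `IsComplexConv α μ ν ρ`. -/
def complexConv (α : ℝ) (μ ν : ComplexMeasure ℝ≥0) : ComplexMeasure ℝ≥0 :=
  if h : ∃ ρ, IsComplexConv α μ ν ρ then h.choose else 0

/-- The Dirac measure `δ₀`, as a complex measure. -/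
def complexDelta : ComplexMeasure ℝ≥0 := VectorMeasure.dirac 0 (1 : ℂ)

end IndexWhittaker

end

/-!
Write `a = 1/2 - α > 0`. The translation `(𝒯^y f)(x)` is the integral of `f` against a law
`δ_x * δ_y` with density `q(x, y, ξ) m(ξ)` (`transKernel`), and the convolution of `μ` and `ν` is
the mixture of these laws over `μ ⊗ ν`. What has to be proved is that these laws are probability
measures, that the functions `𝑾_{α,Δ_λ}` are multiplicative for them, and that finite measures are
determined by their transforms; commutativity and associativity follow at once.

*The law `δ_x * δ_y`.* Inserting the representation `exp_mul_parabolicD` of the parabolic cylinder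
function and evaluating a Gaussian integral by the Cauchy–Schlömilch substitution, one finds a
characterization that does not mention special functions (`map_gammaLaw_eq`): if `T` has a Gamma law
of parameter `2a` and `ξ` is independent of `T` with law `δ_x * δ_y`, then `T ξ²` has the same law
as `T (x² + y² + 2 x² y² T)`. Comparing total masses shows that `δ_x * δ_y` is a probability
measure.

*The product formula.* For `|Re ν| < a`, `Γ(a + ν) 𝑾_{α,ν}(x)` is the confluent integral
`K_ν(c) = ∫₀^∞ e^{-s} s^{a+ν-1} (1 + c s)^{ν-a} ds` at `c = 2 x²` (`boldW_eq_confluent`). A change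
of variables in a double integral writes `K_ν(c) K_{-ν}(d)` as the integral of
`H_ν((1 + c T) (1 + d T))` over the Gamma law of `T`, with a hypergeometric function `H_ν`
(`confluent_mul_confluent`). For `c = 2 x²` and `d = 2 y²` the argument is
`1 + 2 T (x² + y² + 2 x² y² T)`, which by the characterization above has the law of `1 + 2 ξ² T`;
and that is the argument for `c = 2 ξ²` and `d = 0`. Hence `𝑾(x) 𝑾(y)` is the integral of `𝑾(ξ)`
over `δ_x * δ_y` (`integral_boldW_transKernel`). The remaining value `λ = 0` is `ν = a`,
where `𝑾 = 1`.

*Injectivity of the transform.* For `λ = a² + τ²` the index is `i|τ|`, and up to Gamma factors the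
transform of `μ` is the Fourier transform at `τ` of a function of `d` whose value is the Laplace
transform of `L(r²) r^{2a-1} dr` at `2 cosh (d/2)`, where `L(w) = ∫ e^{-2 w x²} μ(dx)`
(`Gamma_mul_integral_boldW`). Fourier inversion and uniqueness for the two Laplace transforms, which
is a moment argument (`ext_of_forall_integral_pow_eq`), recover `μ` (`transform_injective`).

*Complex measures.* A complex measure is a linear combination of finite positive ones, the integral
is linear in the measure, and bounded continuous functions separate complex measures. So existence,
commutativity and associativity pass from positive to complex measures by linearity
(`complexMeasure_induction`).
-/

namespace IndexWhittaker

open Set ProbabilityTheory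

/-! ### The Cauchy–Schlömilch integral -/

theorem lintegral_Ioi_comp_mul (g : ℝ → ENNReal) {c : ℝ} (hc : 0 < c) :
    ∫⁻ x in Ioi (0 : ℝ), g x = ENNReal.ofReal c * ∫⁻ x in Ioi (0 : ℝ), g (c * x) := by
  have himg : (fun x : ℝ => c * x) '' Ioi 0 = Ioi 0 := by
    rw [image_mul_left_Ioi hc, mul_zero]
  have h := lintegral_image_eq_lintegral_abs_deriv_mul (f := fun x : ℝ => c * x)
    (f' := fun _ => c) (s := Ioi 0) measurableSet_Ioi
    (fun x _ => by simpa using ((hasDerivAt_id x).const_mul c).hasDerivWithinAt)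
    (mul_right_injective₀ hc.ne').injOn g
  rw [himg] at h
  rw [h, lintegral_const_mul' _ _ ENNReal.ofReal_ne_top, abs_of_pos hc]

theorem lintegral_Ioi_comp_div (g : ℝ → ENNReal) {c : ℝ} (hc : 0 < c) :
    ∫⁻ x in Ioi (0 : ℝ), g x = ∫⁻ x in Ioi (0 : ℝ), ENNReal.ofReal (c / x ^ 2) * g (c / x) := by
  have himg : (fun x : ℝ => c / x) '' Ioi 0 = Ioi 0 := by
    ext y
    simp only [mem_image, mem_Ioi]
    exact ⟨by rintro ⟨x, hx, rfl⟩; positivity,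
      fun hy => ⟨c / y, by positivity, by field_simp⟩⟩
  have h := lintegral_image_eq_lintegral_abs_deriv_mul (f := fun x : ℝ => c / x)
    (f' := fun x => -(c / x ^ 2)) (s := Ioi 0) measurableSet_Ioi
    (fun x hx => by
      have := ((hasDerivAt_inv (ne_of_gt hx)).const_mul c).hasDerivWithinAt (s := Ioi 0)
      simpa [div_eq_mul_inv] using this)
    (fun x hx y hy hxy => by
      have hx' : x ≠ 0 := ne_of_gt hx
      have hy' : y ≠ 0 := ne_of_gt hy
      field_simp at hxy
      exact hxy.symm) g
  rw [himg] at h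
  rw [h]
  refine setLIntegral_congr_fun measurableSet_Ioi fun x hx => ?_
  rw [abs_neg, abs_of_nonneg (by positivity)]

theorem lintegral_gaussian_neg_sq : ∫⁻ y : ℝ, ENNReal.ofReal (Real.exp (-y ^ 2)) =
    ENNReal.ofReal √Real.pi := by
  have hg := integral_gaussian 1
  have hi := integrable_exp_neg_mul_sq (b := 1) one_pos
  rw [← ofReal_integral_eq_lintegral_ofReal (by simpa using hi)
    (Filter.Eventually.of_forall fun y => (Real.exp_pos _).le)]
  simp at hg
  rw [hg]

theorem hasDerivAt_sub_div (p q : ℝ) {x : ℝ} (hx : x ≠ 0) :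
    HasDerivAt (fun v : ℝ => p * v - q / v) (p + q / x ^ 2) x := by
  have := ((hasDerivAt_id x).const_mul p).sub ((hasDerivAt_inv hx).const_mul q)
  simpa [div_eq_mul_inv] using! this

/-- The Cauchy–Schlömilch substitution `y = p v - q / v` in the Gaussian integral. -/
theorem lintegral_cauchy_schloemilch {p q : ℝ} (hp : 0 < p) (hq : 0 < q) :
    ∫⁻ v in Ioi (0 : ℝ), ENNReal.ofReal ((p + q / v ^ 2) *
      Real.exp (-(p * v) ^ 2 - (q / v) ^ 2)) =
      ENNReal.ofReal (√Real.pi * Real.exp (-2 * p * q)) := by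
  have hinj : InjOn (fun v : ℝ => p * v - q / v) (Ioi 0) := by
    refine StrictMonoOn.injOn fun u hu v hv huv => ?_
    have : q / v < q / u := div_lt_div_of_pos_left hq hu huv
    have : p * u < p * v := by gcongr
    linarith
  have himg : (fun v : ℝ => p * v - q / v) '' Ioi 0 = univ := by
    refine eq_univ_of_forall fun y => ?_
    -- the positive root of `p v² - y v - q = 0`
    have hs : √(y ^ 2 + 4 * p * q) ^ 2 = y ^ 2 + 4 * p * q := Real.sq_sqrt (by positivity)
    have hlt : |y| < √(y ^ 2 + 4 * p * q) := by
      rw [← Real.sqrt_sq_eq_abs]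
      exact Real.sqrt_lt_sqrt (by positivity) (by nlinarith [mul_pos hp hq])
    have hpos : 0 < y + √(y ^ 2 + 4 * p * q) := by linarith [neg_abs_le y]
    refine ⟨(y + √(y ^ 2 + 4 * p * q)) / (2 * p), by simp only [mem_Ioi]; positivity, ?_⟩
    generalize √(y ^ 2 + 4 * p * q) = D at hs hpos
    have hq' : q = (D ^ 2 - y ^ 2) / (4 * p) := by
      rw [hs]
      field_simp
      ring
    have h0 : q / ((y + D) / (2 * p)) = (D - y) / 2 := by
      rw [hq']
      field_simp
      ring
    dsimp only
    rw [h0]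
    field_simp
    ring
  have h := lintegral_image_eq_lintegral_abs_deriv_mul (s := Ioi 0) measurableSet_Ioi
    (fun x hx => (hasDerivAt_sub_div p q (ne_of_gt hx)).hasDerivWithinAt) hinj
    (fun y => ENNReal.ofReal (Real.exp (-y ^ 2)))
  rw [himg, Measure.restrict_univ, lintegral_gaussian_neg_sq] at h
  rw [ENNReal.ofReal_mul (Real.sqrt_nonneg _), h, ← lintegral_mul_const' _ _ ENNReal.ofReal_ne_top]
  refine setLIntegral_congr_fun measurableSet_Ioi fun v hv => ?_
  have hv' : v ≠ 0 := ne_of_gt hv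
  have hpos : 0 ≤ p + q / v ^ 2 := by positivity
  rw [abs_of_nonneg hpos, ← ENNReal.ofReal_mul hpos, ← ENNReal.ofReal_mul (by positivity),
    mul_assoc, ← Real.exp_add]
  congr 3
  field_simp
  ring

/-- `∫₀^∞ (A + B / v²) exp(-(p v)² - (q / v)²) dv = (√π / 2) (A / p + B / q) exp(-2 p q)`. -/
theorem lintegral_exp_sq_add_inv_sq {p q A B : ℝ} (hp : 0 < p) (hq : 0 < q) (hA : 0 ≤ A)
    (hB : 0 ≤ B) :
    ∫⁻ v in Ioi (0 : ℝ), ENNReal.ofReal ((A + B / v ^ 2) *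
      Real.exp (-(p * v) ^ 2 - (q / v) ^ 2)) =
      ENNReal.ofReal (√Real.pi / 2 * (A / p + B / q) * Real.exp (-2 * p * q)) := by
  set E : ℝ → ℝ := fun v => Real.exp (-(p * v) ^ 2 - (q / v) ^ 2) with hE
  have hEm : Measurable E := by fun_prop
  have hE0 : ∀ v, 0 ≤ E v := fun v => (Real.exp_pos _).le
  have split : ∀ A B : ℝ, 0 ≤ A → 0 ≤ B →
      ∫⁻ v in Ioi (0 : ℝ), ENNReal.ofReal ((A + B / v ^ 2) * E v) =
      ENNReal.ofReal A * (∫⁻ v in Ioi (0 : ℝ), ENNReal.ofReal (E v)) +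
      ENNReal.ofReal B * ∫⁻ v in Ioi (0 : ℝ), ENNReal.ofReal (1 / v ^ 2 * E v) := by
    intro A B hA hB
    rw [← lintegral_const_mul _ (by fun_prop), ← lintegral_const_mul _ (by fun_prop),
      ← lintegral_add_left (by fun_prop)]
    refine lintegral_congr fun v => ?_
    rw [← ENNReal.ofReal_mul hA, ← ENNReal.ofReal_mul hB, ← ENNReal.ofReal_add
      (mul_nonneg hA (hE0 v)) (mul_nonneg hB (mul_nonneg (by positivity) (hE0 v)))]
    congr 1
    ring
  set I := ∫⁻ v in Ioi (0 : ℝ), ENNReal.ofReal (E v)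
  set J := ∫⁻ v in Ioi (0 : ℝ), ENNReal.ofReal (1 / v ^ 2 * E v)
  -- the inversion `v ↦ q / (p v)` exchanges the two summands
  have hIJ : ENNReal.ofReal p * I = ENNReal.ofReal q * J := by
    have : I = ENNReal.ofReal (q / p) * J := by
      rw [← lintegral_const_mul _ (by fun_prop)]
      refine (lintegral_Ioi_comp_div _ (div_pos hq hp)).trans ?_
      refine setLIntegral_congr_fun measurableSet_Ioi fun v hv => ?_
      have hv' : v ≠ 0 := ne_of_gt hv
      rw [← ENNReal.ofReal_mul (by positivity), ← ENNReal.ofReal_mul (by positivity), hE]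
      have : -(p * (q / p / v)) ^ 2 - (q / (q / p / v)) ^ 2 = -(p * v) ^ 2 - (q / v) ^ 2 := by
        field_simp
        ring
      dsimp only
      rw [this]
      congr 1
      ring
    rw [this, ← mul_assoc, ← ENNReal.ofReal_mul hp.le, mul_div_cancel₀ _ hp.ne']
  have hsum := lintegral_cauchy_schloemilch hp hq
  rw [split p q hp.le hq.le] at hsum
  have key : ∀ c : ℝ, 0 < c → ∀ K, ENNReal.ofReal c * K + ENNReal.ofReal c * K =
      ENNReal.ofReal (√Real.pi * Real.exp (-2 * p * q)) →
      K = ENNReal.ofReal (√Real.pi / 2 * Real.exp (-2 * p * q) / c) := by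
    intro c hc K h
    rw [← two_mul, ← mul_assoc, ← ENNReal.ofReal_ofNat 2, ← ENNReal.ofReal_mul (by norm_num),
      mul_comm] at h
    rw [ENNReal.eq_div_iff (by simpa using hc) ENNReal.ofReal_ne_top |>.2 ((mul_comm _ _).trans h),
      ← ENNReal.ofReal_div_of_pos (by positivity)]
    congr 1
    field_simp
  -- `p I + q J` is known and `p I = q J`, so each summand is half of it
  have hI := key p hp I (by rw [← hsum, hIJ])
  have hJ := key q hq J (by rw [← hsum, hIJ])
  rw [split A B hA hB, hI, hJ, ← ENNReal.ofReal_mul hA, ← ENNReal.ofReal_mul hB,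
    ← ENNReal.ofReal_add (by positivity) (by positivity)]
  congr 1
  field_simp

/-! ### An integral representation of the parabolic cylinder function -/

theorem lintegral_Ioi_comp_sq (g : ℝ → ENNReal) :
    ∫⁻ x in Ioi (0 : ℝ), g x = ∫⁻ x in Ioi (0 : ℝ), ENNReal.ofReal (2 * x) * g (x ^ 2) := by
  have himg : (fun x : ℝ => x ^ 2) '' Ioi 0 = Ioi 0 := by
    ext y
    simp only [mem_image, mem_Ioi]
    exact ⟨by rintro ⟨x, hx, rfl⟩; positivity,
      fun hy => ⟨√y, by positivity, Real.sq_sqrt hy.le⟩⟩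
  have h := lintegral_image_eq_lintegral_abs_deriv_mul (f := fun x : ℝ => x ^ 2)
    (f' := fun x => 2 * x) (s := Ioi 0) measurableSet_Ioi
    (fun x _ => by simpa using (hasDerivAt_pow 2 x).hasDerivWithinAt)
    (fun x hx y hy hxy => (pow_left_inj₀ (le_of_lt hx) (le_of_lt hy) two_ne_zero).1 hxy) g
  rw [himg] at h
  rw [h]
  refine setLIntegral_congr_fun measurableSet_Ioi fun x hx => ?_
  have hx' : (0 : ℝ) < x := hx
  rw [abs_of_pos (by positivity)]

theorem integrableOn_rpow_mul_exp_neg_mul_rpow' {p q b : ℝ} (hp : 0 < p) (hq : -1 < q)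
    (hb : 0 < b) :
    IntegrableOn (fun x : ℝ => x ^ q * Real.exp (-b * x ^ p)) (Ioi 0) := by
  refine Integrable.of_integral_ne_zero ?_
  rw [integral_rpow_mul_exp_neg_mul_rpow hp hq hb]
  have : 0 < Real.Gamma ((q + 1) / p) := Real.Gamma_pos_of_pos (div_pos (by linarith) hp)
  positivity

theorem lintegral_rpow_mul_exp_neg_mul_rpow {p q b : ℝ} (hp : 0 < p) (hq : -1 < q) (hb : 0 < b) :
    ∫⁻ x in Ioi (0 : ℝ), ENNReal.ofReal (x ^ q * Real.exp (-b * x ^ p)) =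
      ENNReal.ofReal (b ^ (-(q + 1) / p) * (1 / p) * Real.Gamma ((q + 1) / p)) := by
  rw [← integral_rpow_mul_exp_neg_mul_rpow hp hq hb, ofReal_integral_eq_lintegral_ofReal
    (integrableOn_rpow_mul_exp_neg_mul_rpow' hp hq hb)]
  refine (ae_restrict_iff' measurableSet_Ioi).2 (Filter.Eventually.of_forall fun x hx => ?_)
  have hx' : (0 : ℝ) < x := hx
  dsimp only [Pi.zero_apply]
  positivity

theorem lintegral_rpow_mul_exp_neg_mul {q b : ℝ} (hq : 0 < q) (hb : 0 < b) :
    ∫⁻ x in Ioi (0 : ℝ), ENNReal.ofReal (x ^ (q - 1) * Real.exp (-b * x)) =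
      ENNReal.ofReal (b ^ (-q) * Real.Gamma q) := by
  simpa using lintegral_rpow_mul_exp_neg_mul_rpow one_pos (q := q - 1) (by linarith) hb

theorem integrableOn_parabolic {a c : ℝ} (ha : 0 < a) (hc : 0 < c) :
    IntegrableOn (fun t : ℝ => Real.exp (-c * t) * t ^ (a - 1) * (1 + t) ^ (1 / 2 - a))
      (Ioi 0) := by
  have h1 := integrableOn_rpow_mul_exp_neg_mul_rpow' one_pos (q := a - 1) (by linarith) hc
  have h2 := integrableOn_rpow_mul_exp_neg_mul_rpow' one_pos (q := a) (by linarith) hc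
  refine Integrable.mono' (h1.add h2) (by fun_prop) ?_
  refine (ae_restrict_iff' measurableSet_Ioi).2 (Filter.Eventually.of_forall fun t ht => ?_)
  have ht' : (0 : ℝ) < t := ht
  rw [Real.norm_of_nonneg (by positivity)]
  have hle : (1 + t) ^ (1 / 2 - a) ≤ 1 + t := by
    calc (1 + t) ^ (1 / 2 - a) ≤ (1 + t) ^ (1 : ℝ) :=
          Real.rpow_le_rpow_of_exponent_le (by linarith) (by linarith)
      _ = 1 + t := Real.rpow_one _
  calc Real.exp (-c * t) * t ^ (a - 1) * (1 + t) ^ (1 / 2 - a)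
      ≤ Real.exp (-c * t) * t ^ (a - 1) * (1 + t) := by gcongr
    _ = _ := by
      have : t ^ a = t ^ (a - 1) * t := by
        rw [← Real.rpow_add_one ht'.ne']; ring_nf
      simp only [Pi.add_apply, Real.rpow_one, this]
      ring

/-- `(z + s) e^{-zs}` as a mixture of Gaussians in `z` and `s`. It separates the two variables in
the proof of `exp_mul_parabolicD`. -/
theorem add_mul_exp_neg_mul_eq_lintegral {z s : ℝ} (hz : 0 < z) (hs : 0 < s) :
    ENNReal.ofReal ((z + s) * Real.exp (-(z * s))) =
      ∫⁻ v in Ioi (0 : ℝ), ENNReal.ofReal (z * s / √(2 * Real.pi) * 2 * (1 + 1 / v ^ 2) *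
        Real.exp (-(z ^ 2 / 2 * v ^ 2) - s ^ 2 / 2 / v ^ 2)) := by
  have h2 : √2 ^ 2 = (2 : ℝ) := Real.sq_sqrt (by norm_num)
  have h := lintegral_exp_sq_add_inv_sq (p := z / √2) (q := s / √2) (A := 1) (B := 1)
    (by positivity) (by positivity) zero_le_one zero_le_one
  have hc : 0 ≤ z * s / √(2 * Real.pi) * 2 := by positivity
  calc _ = ENNReal.ofReal (z * s / √(2 * Real.pi) * 2) *
        ENNReal.ofReal (√Real.pi / 2 * (1 / (z / √2) + 1 / (s / √2)) *
          Real.exp (-2 * (z / √2) * (s / √2))) := by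
        rw [← ENNReal.ofReal_mul hc]
        congr 1
        have e : -2 * (z / √2) * (s / √2) = -(z * s) := by
          field_simp
          rw [h2]
        rw [e, Real.sqrt_mul (by norm_num)]
        field_simp
        ring
    _ = _ := by
        rw [← h, ← lintegral_const_mul' _ _ ENNReal.ofReal_ne_top]
        refine setLIntegral_congr_fun measurableSet_Ioi fun v hv => ?_
        rw [← ENNReal.ofReal_mul hc, ← mul_assoc]
        congr 3
        rw [mul_pow, div_pow, div_pow, div_pow, h2]

/-- The representation `e^{-z²/4} D_{2α}(z) = Γ(1-2α)⁻¹ ∫₀^∞ (z+s) e^{-(z+s)²/2} s^{-2α} ds` of the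
parabolic cylinder function, written with `a = 1/2 - α`. -/
theorem exp_mul_parabolicD {α a z : ℝ} (haα : a = 1 / 2 - α) (ha : 0 < a) (hz : 0 < z) :
    ENNReal.ofReal (Real.exp (-(z ^ 2 / 4)) * parabolicD (2 * α) z) =
      ENNReal.ofReal (Real.Gamma (2 * a))⁻¹ * ∫⁻ s in Ioi (0 : ℝ),
        ENNReal.ofReal ((z + s) * Real.exp (-((z + s) ^ 2 / 2)) * s ^ (2 * a - 1)) := by
  have hG2 : 0 < Real.Gamma (2 * a) := Real.Gamma_pos_of_pos (by linarith)
  have hG : 0 < Real.Gamma a := Real.Gamma_pos_of_pos ha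
  have hGh : 0 < Real.Gamma (a + 1 / 2) := Real.Gamma_pos_of_pos (by linarith)
  set C : ℝ := z / √(2 * Real.pi) * 2 * Real.exp (-(z ^ 2 / 2)) with hC
  have hC0 : 0 ≤ C := by positivity
  set K : ℝ := 2 ^ (a + 1 / 2) / 2 * Real.Gamma (a + 1 / 2) with hK
  have hK0 : 0 ≤ K := by positivity
  -- the integral over `s`, after interchanging the order of integration
  have step1 : ∫⁻ s in Ioi (0 : ℝ),
        ENNReal.ofReal ((z + s) * Real.exp (-((z + s) ^ 2 / 2)) * s ^ (2 * a - 1)) =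
      ∫⁻ v in Ioi (0 : ℝ), ∫⁻ s in Ioi (0 : ℝ),
        ENNReal.ofReal (C * (1 + 1 / v ^ 2) * Real.exp (-(z ^ 2 / 2 * v ^ 2))) *
        ENNReal.ofReal (s ^ (2 * a) * Real.exp (-((1 + 1 / v ^ 2) / 2) * s ^ (2 : ℝ))) := by
    rw [lintegral_lintegral_swap (by fun_prop)]
    refine setLIntegral_congr_fun measurableSet_Ioi fun s hs => ?_
    have hs' : (0 : ℝ) < s := hs
    have : (z + s) * Real.exp (-((z + s) ^ 2 / 2)) * s ^ (2 * a - 1) =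
        (Real.exp (-(z ^ 2 / 2) - s ^ 2 / 2) * s ^ (2 * a - 1)) *
          ((z + s) * Real.exp (-(z * s))) := by
      rw [show -((z + s) ^ 2 / 2) = (-(z ^ 2 / 2) - s ^ 2 / 2) + -(z * s) by ring, Real.exp_add]
      ring
    rw [this, ENNReal.ofReal_mul (by positivity), add_mul_exp_neg_mul_eq_lintegral hz hs',
      ← lintegral_const_mul' _ _ ENNReal.ofReal_ne_top]
    refine setLIntegral_congr_fun measurableSet_Ioi fun v hv => ?_
    have hv' : (0 : ℝ) < v := hv
    rw [← ENNReal.ofReal_mul (by positivity), ← ENNReal.ofReal_mul (by positivity)]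
    congr 1
    have e1 : s ^ (2 * a) = s ^ (2 * a - 1) * s := by
      rw [← Real.rpow_add_one hs'.ne']; ring_nf
    have e2 : Real.exp (-(z ^ 2 / 2 * v ^ 2) - s ^ 2 / 2 / v ^ 2) *
        Real.exp (-(z ^ 2 / 2) - s ^ 2 / 2) =
        Real.exp (-(z ^ 2 / 2)) * Real.exp (-(z ^ 2 / 2 * v ^ 2)) *
          Real.exp (-((1 + 1 / v ^ 2) / 2) * s ^ (2 : ℝ)) := by
      rw [← Real.exp_add, ← Real.exp_add, ← Real.exp_add, Real.rpow_two]
      congr 1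
      field_simp
      ring
    rw [e1, hC]
    linear_combination (z * s / √(2 * Real.pi) * 2 * (1 + 1 / v ^ 2) * s ^ (2 * a - 1)) * e2
  -- the inner integral is a Gamma integral; `2 v dv` anticipates the substitution `t = v²`
  have step2 : ∀ v ∈ Ioi (0 : ℝ), ∫⁻ s in Ioi (0 : ℝ),
        ENNReal.ofReal (C * (1 + 1 / v ^ 2) * Real.exp (-(z ^ 2 / 2 * v ^ 2))) *
        ENNReal.ofReal (s ^ (2 * a) * Real.exp (-((1 + 1 / v ^ 2) / 2) * s ^ (2 : ℝ))) =
      ENNReal.ofReal (C / 2 * K) * (ENNReal.ofReal (2 * v) * ENNReal.ofReal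
        (Real.exp (-(z ^ 2 / 2) * v ^ 2) * (v ^ 2) ^ (a - 1) * (1 + v ^ 2) ^ (1 / 2 - a))) := by
    intro v hv
    have hv' : (0 : ℝ) < v := hv
    rw [lintegral_const_mul' _ _ ENNReal.ofReal_ne_top,
      lintegral_rpow_mul_exp_neg_mul_rpow two_pos (by linarith) (by positivity),
      ← ENNReal.ofReal_mul (by positivity), ← ENNReal.ofReal_mul (by positivity),
      ← ENNReal.ofReal_mul (by positivity)]
    congr 1
    have e0 : (1 + 1 / v ^ 2) / 2 = (1 + v ^ 2) * (v ^ 2)⁻¹ * 2⁻¹ := by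
      field_simp
      ring
    have e1 : -(2 * a + 1) / 2 = -(a + 1 / 2) := by ring
    have e2 : (2 * a + 1) / 2 = a + 1 / 2 := by ring
    have e3 : ((1 + 1 / v ^ 2) / 2) ^ (-(a + 1 / 2)) =
        (1 + v ^ 2) ^ (1 / 2 - a) * (1 + v ^ 2)⁻¹ * ((v ^ 2) ^ (a - 1) * v ^ 2 * v) *
          2 ^ (a + 1 / 2) := by
      rw [e0, Real.mul_rpow (by positivity) (by positivity), Real.mul_rpow (by positivity)
        (by positivity), Real.inv_rpow two_pos.le, Real.inv_rpow (sq_nonneg v),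
        Real.rpow_neg two_pos.le, Real.rpow_neg (sq_nonneg v), inv_inv, inv_inv]
      congr 2
      · rw [← Real.rpow_neg_one (1 + v ^ 2), ← Real.rpow_add (by positivity)]
        ring_nf
      · have ev : (v ^ 2) ^ (1 / 2 : ℝ) = v := by rw [← Real.sqrt_eq_rpow, Real.sqrt_sq hv'.le]
        rw [← Real.rpow_add_one (by positivity)]
        nth_rw 3 [← ev]
        rw [← Real.rpow_add (by positivity)]
        ring_nf
    rw [e1, e2, e3, hK, neg_mul]
    field_simp
    ring
  rw [step1, setLIntegral_congr_fun measurableSet_Ioi step2,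
    lintegral_const_mul' _ _ ENNReal.ofReal_ne_top,
    ← lintegral_Ioi_comp_sq (fun t => ENNReal.ofReal
      (Real.exp (-(z ^ 2 / 2) * t) * t ^ (a - 1) * (1 + t) ^ (1 / 2 - a))),
    ← ofReal_integral_eq_lintegral_ofReal (integrableOn_parabolic ha (by positivity))
      ((ae_restrict_iff' measurableSet_Ioi).2 (Filter.Eventually.of_forall fun t ht => by
        have ht' : (0 : ℝ) < t := ht
        dsimp only [Pi.zero_apply]
        positivity)),
    ← ENNReal.ofReal_mul (by positivity), ← ENNReal.ofReal_mul (by positivity)]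
  congr 1
  have e1 : (2 * α - 1) / 2 = -a := by rw [haα]; ring
  have e2 : (1 - 2 * α) / 2 = a := by rw [haα]; ring
  have e3 : 2 * α / 2 = 1 / 2 - a := by rw [haα]; ring
  rw [parabolicD, e1, e2, e3]
  generalize ∫ t in Ioi (0 : ℝ), Real.exp (-(z ^ 2 / 2) * t) * t ^ (a - 1) * (1 + t) ^ (1 / 2 - a)
    = J
  -- the constants agree by Legendre's duplication formula
  have leg := Real.Gamma_mul_Gamma_add_half a
  have e4 : Real.exp (-(z ^ 2 / 2)) = Real.exp (-(z ^ 2 / 4)) * Real.exp (-(z ^ 2 / 4)) := by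
    rw [← Real.exp_add]; ring_nf
  have e5 : (2 : ℝ) ^ (a + 1 / 2) = 2 ^ a * √2 := by
    rw [Real.rpow_add two_pos, Real.sqrt_eq_rpow]
  have e6 : (2 : ℝ) ^ (1 - 2 * a) = 2 / (2 ^ a * 2 ^ a) := by
    rw [Real.rpow_sub two_pos, Real.rpow_one, two_mul, Real.rpow_add two_pos]
  rw [e6] at leg
  have h2a : (0 : ℝ) < 2 ^ a := by positivity
  rw [hC, hK, e4, e5, Real.rpow_neg two_pos.le, Real.sqrt_mul two_pos.le]
  field_simp at leg ⊢
  linear_combination (-J) * leg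

/-! ### The density of the translation -/

/-- The density `q(x, y, ξ) m(ξ)` of the translation, with the parabolic cylinder function replaced
by its representation from `exp_mul_parabolicD`. -/
theorem kernelQ_mul_weight {α a x y ξ : ℝ} (haα : a = 1 / 2 - α) (ha : 0 < a) (hx : 0 < x)
    (hy : 0 < y) (hξ : 0 < ξ) :
    ENNReal.ofReal (kernelQ α x y ξ * weight α ξ) =
      ENNReal.ofReal ((√(2 * Real.pi))⁻¹ * (x * y) ^ (-(2 * a)) *
        Real.exp ((x ^ 2 + y ^ 2) / (2 * (x * y) ^ 2)) * (Real.Gamma (2 * a))⁻¹ *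
          ξ ^ (2 * a - 1)) *
      ∫⁻ s in Ioi (0 : ℝ), ENNReal.ofReal (
        (((x ^ 2 + y ^ 2 + ξ ^ 2) / (2 * x * y * ξ)) + s) *
        Real.exp (-((((x ^ 2 + y ^ 2 + ξ ^ 2) / (2 * x * y * ξ)) + s) ^ 2 / 2)) *
          s ^ (2 * a - 1)) := by
  have hG2 : 0 < Real.Gamma (2 * a) := Real.Gamma_pos_of_pos (by linarith)
  set z := (x ^ 2 + y ^ 2 + ξ ^ 2) / (2 * x * y * ξ) with hz
  have hz0 : 0 < z := by positivity
  have h : kernelQ α x y ξ * weight α ξ = ((√(2 * Real.pi))⁻¹ * (x * y) ^ (-(2 * a)) *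
        Real.exp ((x ^ 2 + y ^ 2) / (2 * (x * y) ^ 2)) * ξ ^ (2 * a - 1)) *
        (Real.exp (-(z ^ 2 / 4)) * parabolicD (2 * α) z) := by
    have e1 : -1 + 2 * α = -(2 * a) := by rw [haα]; ring
    have e2 : 1 - 4 * α = (2 * a - 1) + 2 * a := by rw [haα]; ring
    have e3 : Real.exp (1 / (2 * x ^ 2) + 1 / (2 * y ^ 2) + 1 / (2 * ξ ^ 2)
        - ((x ^ 2 + y ^ 2 + ξ ^ 2) / (4 * x * y * ξ)) ^ 2) * Real.exp (-(1 / (2 * ξ ^ 2))) =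
        Real.exp ((x ^ 2 + y ^ 2) / (2 * (x * y) ^ 2)) * Real.exp (-(z ^ 2 / 4)) := by
      rw [← Real.exp_add, ← Real.exp_add, hz]
      congr 1
      field_simp
      ring
    have e4 : (2 * Real.pi) ^ (-(1 / 2) : ℝ) = (√(2 * Real.pi))⁻¹ := by
      rw [Real.rpow_neg (by positivity), Real.sqrt_eq_rpow]
    have e5 : (x * y * ξ) ^ (-(2 * a)) * ξ ^ (2 * a - 1 + 2 * a) =
        (x * y) ^ (-(2 * a)) * ξ ^ (2 * a - 1) := by
      rw [Real.mul_rpow (by positivity) hξ.le, mul_assoc, ← Real.rpow_add hξ]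
      congr 2
      ring
    rw [kernelQ, weight, e1, e2, e4, ← hz]
    linear_combination (√(2 * Real.pi))⁻¹ * parabolicD (2 * α) z *
      ((x * y * ξ) ^ (-(2 * a)) * ξ ^ (2 * a - 1 + 2 * a) * e3 +
        Real.exp ((x ^ 2 + y ^ 2) / (2 * (x * y) ^ 2)) * Real.exp (-(z ^ 2 / 4)) * e5)
  rw [h, ENNReal.ofReal_mul (by positivity), exp_mul_parabolicD haα ha hz0, ← mul_assoc,
    ← ENNReal.ofReal_mul (by positivity)]
  congr 2
  ring

/-- The inner integral over `ξ` in `lintegral_kernelQ_mul_weight`; `S` and `k` stand for `x² + y²`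
and `x y`. -/
theorem lintegral_translation_gaussian {S k T l : ℝ} (hS : 0 < S) (hk : 0 < k) (hT : 0 < T)
    (hl : 0 < l) :
    ∫⁻ ξ in Ioi (0 : ℝ), ENNReal.ofReal (((1 + l) + S / ξ ^ 2) / (2 * k) *
      Real.exp (-(T * (S + 2 * k ^ 2 * T) / ξ ^ 2) -
        ((S / ξ + (1 + l) * ξ) / (2 * k)) ^ 2 / 2)) =
    ENNReal.ofReal (√(2 * Real.pi) * (S + 2 * k ^ 2 * T) / (S + 4 * k ^ 2 * T) *
      Real.exp (-((S + 2 * k ^ 2 * T) / (2 * k ^ 2)) * (1 + l))) := by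
  have h2 : √2 ^ 2 = (2 : ℝ) := Real.sq_sqrt (by norm_num)
  set E := Real.exp (-(S * (1 + l) / (4 * k ^ 2))) with hE
  have h := lintegral_exp_sq_add_inv_sq (p := (1 + l) / (2 * k * √2))
    (q := (S + 4 * k ^ 2 * T) / (2 * k * √2)) (A := 1 + l) (B := S)
    (by positivity) (by positivity) (by positivity) hS.le
  have hE0 : 0 ≤ E / (2 * k) := by positivity
  calc _ = ENNReal.ofReal (E / (2 * k)) * ∫⁻ v in Ioi (0 : ℝ), ENNReal.ofReal ((1 + l + S / v ^ 2) *
          Real.exp (-((1 + l) / (2 * k * √2) * v) ^ 2 -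
            ((S + 4 * k ^ 2 * T) / (2 * k * √2) / v) ^ 2)) := by
        rw [← lintegral_const_mul' _ _ ENNReal.ofReal_ne_top]
        refine setLIntegral_congr_fun measurableSet_Ioi fun v hv => ?_
        have hv' : (0 : ℝ) < v := hv
        rw [← ENNReal.ofReal_mul hE0]
        congr 1
        have : Real.exp (-(T * (S + 2 * k ^ 2 * T) / v ^ 2) -
            ((S / v + (1 + l) * v) / (2 * k)) ^ 2 / 2) = E *
            Real.exp (-((1 + l) / (2 * k * √2) * v) ^ 2 -
              ((S + 4 * k ^ 2 * T) / (2 * k * √2) / v) ^ 2) := by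
          rw [hE, ← Real.exp_add]
          congr 1
          simp only [div_pow, mul_pow, h2]
          field_simp
          ring
        rw [this]
        ring
    _ = _ := by
        rw [h, ← ENNReal.ofReal_mul hE0]
        congr 1
        have : Real.exp (-((S + 2 * k ^ 2 * T) / (2 * k ^ 2)) * (1 + l)) =
            E * Real.exp (-2 * ((1 + l) / (2 * k * √2)) *
              ((S + 4 * k ^ 2 * T) / (2 * k * √2))) := by
          rw [hE, ← Real.exp_add]
          congr 1
          have : -2 * ((1 + l) / (2 * k * √2)) * ((S + 4 * k ^ 2 * T) / (2 * k * √2)) =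
            -2 * (1 + l) * (S + 4 * k ^ 2 * T) / (4 * k ^ 2 * √2 ^ 2) := by
              field_simp
              ring
          rw [this, h2]
          field_simp
          ring
        rw [this, Real.sqrt_mul two_pos.le]
        field_simp
        ring

/-- The mean of `ξ^{-4a} e^{-w/ξ²}` under `q(x, y, ξ) m(ξ) dξ`, in closed form once `w` is
parametrized as `w = T (x² + y² + 2 x² y² T)`. Up to the factor `w^{2a-1}`, the two sides are the
densities in `w` of the laws compared in `map_gammaLaw_eq`. -/
theorem lintegral_kernelQ_mul_weight {α a x y T : ℝ} (haα : a = 1 / 2 - α) (ha : 0 < a)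
    (hx : 0 < x) (hy : 0 < y) (hT : 0 < T) :
    ∫⁻ ξ in Ioi (0 : ℝ), ENNReal.ofReal (kernelQ α x y ξ * weight α ξ) *
      ENNReal.ofReal (ξ ^ (-(4 * a)) *
        Real.exp (-(T * (x ^ 2 + y ^ 2 + 2 * (x * y) ^ 2 * T) / ξ ^ 2))) =
    ENNReal.ofReal ((x ^ 2 + y ^ 2 + 2 * (x * y) ^ 2 * T) ^ (1 - 2 * a) * Real.exp (-T) /
      (x ^ 2 + y ^ 2 + 4 * (x * y) ^ 2 * T)) := by
  have hG2 : 0 < Real.Gamma (2 * a) := Real.Gamma_pos_of_pos (by linarith)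
  set S := x ^ 2 + y ^ 2 with hS
  have hS0 : 0 < S := by positivity
  set k := x * y with hk
  have hk0 : 0 < k := by positivity
  set c : ℝ := (√(2 * Real.pi))⁻¹ * k ^ (-(2 * a)) * Real.exp (S / (2 * k ^ 2)) *
    (Real.Gamma (2 * a))⁻¹ with hc
  have hc0 : 0 ≤ c := by positivity
  set w := T * (S + 2 * k ^ 2 * T) with hw
  set κ := (S + 2 * k ^ 2 * T) / (2 * k ^ 2) with hκ
  have hκ0 : 0 < κ := by positivity
  -- substitute `s = l ξ / (2 k)` in the integral representing the parabolic cylinder function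
  have step1 : ∀ ξ ∈ Ioi (0 : ℝ), ENNReal.ofReal (kernelQ α x y ξ * weight α ξ) *
      ENNReal.ofReal (ξ ^ (-(4 * a)) * Real.exp (-(w / ξ ^ 2))) =
      ENNReal.ofReal (c * (2 * k) ^ (-(2 * a))) * ∫⁻ l in Ioi (0 : ℝ),
        ENNReal.ofReal (l ^ (2 * a - 1)) * ENNReal.ofReal (((1 + l) + S / ξ ^ 2) / (2 * k) *
          Real.exp (-(w / ξ ^ 2) - ((S / ξ + (1 + l) * ξ) / (2 * k)) ^ 2 / 2)) := by
    intro ξ hξ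
    have hξ' : (0 : ℝ) < ξ := hξ
    rw [kernelQ_mul_weight haα ha hx hy hξ', lintegral_Ioi_comp_mul _
      (show 0 < ξ / (2 * k) by positivity), ← mul_assoc, ← ENNReal.ofReal_mul (by positivity),
      mul_comm, ← mul_assoc, ← ENNReal.ofReal_mul (by positivity),
      ← lintegral_const_mul' _ _ ENNReal.ofReal_ne_top,
      ← lintegral_const_mul' _ _ ENNReal.ofReal_ne_top]
    refine setLIntegral_congr_fun measurableSet_Ioi fun l hl => ?_
    have hl' : (0 : ℝ) < l := hl
    rw [← ENNReal.ofReal_mul (by positivity), ← ENNReal.ofReal_mul (by positivity),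
      ← ENNReal.ofReal_mul (by positivity)]
    congr 1
    have e1 : (x ^ 2 + y ^ 2 + ξ ^ 2) / (2 * x * y * ξ) + ξ / (2 * k) * l =
        (S / ξ + (1 + l) * ξ) / (2 * k) := by
      rw [hS, hk]
      field_simp
      ring
    have e2 : (ξ / (2 * k) * l) ^ (2 * a - 1) =
        ξ ^ (2 * a) * ξ⁻¹ * ((2 * k) ^ (-(2 * a)) * (2 * k)) * l ^ (2 * a - 1) := by
      rw [Real.mul_rpow (by positivity) hl'.le, Real.div_rpow hξ'.le (by positivity),
        Real.rpow_sub_one hξ'.ne', Real.rpow_sub_one (by positivity), Real.rpow_neg (by positivity)]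
      field_simp
    have e3 : ξ ^ (-(4 * a)) = (ξ ^ (2 * a) * ξ ^ (2 * a))⁻¹ := by
      rw [Real.rpow_neg hξ'.le, ← Real.rpow_add hξ']
      ring_nf
    rw [e1, e2, e3, sub_eq_add_neg (-(w / ξ ^ 2)), Real.exp_add, Real.rpow_sub_one hξ'.ne', ← hc]
    have : 0 < ξ ^ (2 * a) := by positivity
    field_simp
    ring
  have step2 : ∀ l ∈ Ioi (0 : ℝ), ∫⁻ ξ in Ioi (0 : ℝ),
        ENNReal.ofReal (l ^ (2 * a - 1)) * ENNReal.ofReal (((1 + l) + S / ξ ^ 2) / (2 * k) *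
          Real.exp (-(w / ξ ^ 2) - ((S / ξ + (1 + l) * ξ) / (2 * k)) ^ 2 / 2)) =
      ENNReal.ofReal (√(2 * Real.pi) * (S + 2 * k ^ 2 * T) / (S + 4 * k ^ 2 * T) *
        Real.exp (-κ)) * ENNReal.ofReal (l ^ (2 * a - 1) * Real.exp (-κ * l)) := by
    intro l hl
    have hl' : (0 : ℝ) < l := hl
    rw [lintegral_const_mul' _ _ ENNReal.ofReal_ne_top,
      lintegral_translation_gaussian hS0 hk0 hT hl', ← ENNReal.ofReal_mul (by positivity),
      ← ENNReal.ofReal_mul (by positivity), ← hκ,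
      show -κ * (1 + l) = -κ + -κ * l by ring, Real.exp_add]
    congr 1
    ring
  rw [setLIntegral_congr_fun measurableSet_Ioi step1,
    lintegral_const_mul' _ _ ENNReal.ofReal_ne_top, lintegral_lintegral_swap (by fun_prop),
    setLIntegral_congr_fun measurableSet_Ioi step2,
    lintegral_const_mul' _ _ ENNReal.ofReal_ne_top,
    lintegral_rpow_mul_exp_neg_mul (by positivity) hκ0, ← ENNReal.ofReal_mul (by positivity),
    ← ENNReal.ofReal_mul (by positivity)]
  congr 1
  have e1 : κ = S / (2 * k ^ 2) + T := by rw [hκ]; field_simp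
  have e2 : Real.exp (-κ) = (Real.exp (S / (2 * k ^ 2)))⁻¹ * Real.exp (-T) := by
    rw [e1, neg_add, Real.exp_add, Real.exp_neg (S / _)]
  have e3 : κ ^ (-(2 * a)) =
      (S + 2 * k ^ 2 * T) ^ (-(2 * a)) * ((2 * k) ^ (2 * a) * k ^ (2 * a)) := by
    rw [hκ, Real.div_rpow (by positivity) (by positivity), ← Real.mul_rpow (by positivity) hk0.le,
      Real.rpow_neg (by positivity : 0 ≤ 2 * k ^ 2)]
    field_simp
  rw [e2, e3, hc, Real.rpow_neg hk0.le, Real.rpow_neg (by positivity : 0 ≤ 2 * k),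
    sub_eq_add_neg 1, Real.rpow_add (by positivity), Real.rpow_one]
  field_simp

/-! ### The laws `δ_x * δ_y` -/

theorem measurable_parabolicD (p : ℝ) : Measurable (parabolicD p) := by
  have h : StronglyMeasurable (fun z : ℝ => ∫ t in Ioi (0 : ℝ),
      Real.exp (-(z ^ 2 / 2) * t) * t ^ ((1 - p) / 2 - 1) * (1 + t) ^ (p / 2)) := by
    refine StronglyMeasurable.integral_prod_right (f := fun (z t : ℝ) =>
      Real.exp (-(z ^ 2 / 2) * t) * t ^ ((1 - p) / 2 - 1) * (1 + t) ^ (p / 2)) ?_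
    exact Measurable.stronglyMeasurable (by fun_prop)
  have h' := h.measurable
  unfold parabolicD
  fun_prop

theorem measurable_kernelQ_mul_weight (α : ℝ) : Measurable
    (fun p : (ℝ≥0 × ℝ≥0) × ℝ => kernelQ α p.1.1 p.1.2 p.2 * weight α p.2) := by
  have h := measurable_parabolicD (2 * α)
  unfold kernelQ weight
  fun_prop

theorem parabolicD_nonneg {α z : ℝ} (hα : α < 1 / 2) (hz : 0 ≤ z) : 0 ≤ parabolicD (2 * α) z := by
  have hG : 0 < Real.Gamma ((1 - 2 * α) / 2) := Real.Gamma_pos_of_pos (by linarith)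
  have : 0 ≤ ∫ t in Ioi (0 : ℝ), Real.exp (-(z ^ 2 / 2) * t) * t ^ ((1 - 2 * α) / 2 - 1) *
      (1 + t) ^ (2 * α / 2) := by
    refine setIntegral_nonneg measurableSet_Ioi fun t ht => ?_
    have ht' : (0 : ℝ) < t := ht
    positivity
  unfold parabolicD
  positivity

theorem kernelQ_mul_weight_nonneg {α x y ξ : ℝ} (hα : α < 1 / 2) (hx : 0 ≤ x) (hy : 0 ≤ y)
    (hξ : 0 ≤ ξ) : 0 ≤ kernelQ α x y ξ * weight α ξ := by
  have := parabolicD_nonneg hα (z := (x ^ 2 + y ^ 2 + ξ ^ 2) / (2 * x * y * ξ)) (by positivity)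
  unfold kernelQ weight
  positivity

/-- The kernel of measures `(x, y) ↦ δ_x * δ_y` behind the translation: `(𝒯^y f)(x)` is the
integral of `f` with respect to `transKernel α (x, y)`. -/
noncomputable def transKernel (α : ℝ) : Kernel (ℝ≥0 × ℝ≥0) ℝ≥0 := by
  classical
  exact Kernel.piecewise (s := {p | p.1 = 0})
    (measurableSet_eq_fun measurable_fst measurable_const)
    (Kernel.deterministic Prod.snd measurable_snd)
    (Kernel.piecewise (s := {p | p.2 = 0})
      (measurableSet_eq_fun measurable_snd measurable_const)
      (Kernel.deterministic Prod.fst measurable_fst)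
      (((Kernel.const _ (volume.restrict (Ioi (0 : ℝ)))).withDensity
        (fun p ξ => ENNReal.ofReal (kernelQ α p.1 p.2 ξ * weight α ξ))).map Real.toNNReal))

theorem transKernel_zero_left (α : ℝ) (y : ℝ≥0) : transKernel α (0, y) = Measure.dirac y := by
  simp [transKernel, Kernel.piecewise_apply, Kernel.deterministic_apply]

theorem transKernel_zero_right (α : ℝ) (x : ℝ≥0) : transKernel α (x, 0) = Measure.dirac x := by
  by_cases hx : x = 0
  · rw [hx, transKernel_zero_left]
  · simp [transKernel, Kernel.piecewise_apply, Kernel.deterministic_apply, hx]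

theorem transKernel_of_ne_zero (α : ℝ) {x y : ℝ≥0} (hx : x ≠ 0) (hy : y ≠ 0) :
    transKernel α (x, y) = ((volume.restrict (Ioi (0 : ℝ))).withDensity
      (fun ξ => ENNReal.ofReal (kernelQ α x y ξ * weight α ξ))).map Real.toNNReal := by
  have hm := (measurable_kernelQ_mul_weight α).ennreal_ofReal
  simp only [transKernel, Kernel.piecewise_apply, mem_ofPred_eq, hx, hy, if_false]
  rw [Kernel.map_apply _ measurable_real_toNNReal, Kernel.withDensity_apply _ hm,
    Kernel.const_apply]

theorem lintegral_transKernel {α : ℝ} {x y : ℝ≥0} (hx : x ≠ 0) (hy : y ≠ 0)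
    {f : ℝ≥0 → ENNReal} (hf : Measurable f) :
    ∫⁻ ξ, f ξ ∂transKernel α (x, y) = ∫⁻ ξ in Ioi (0 : ℝ),
      ENNReal.ofReal (kernelQ α x y ξ * weight α ξ) * f ξ.toNNReal := by
  have hm := ((measurable_kernelQ_mul_weight α).comp
    (measurable_prodMk_left (x := (x, y)))).ennreal_ofReal
  simp only [Function.comp_def] at hm
  rw [transKernel_of_ne_zero α hx hy, lintegral_map hf measurable_real_toNNReal,
    lintegral_withDensity_eq_lintegral_mul _ hm (by fun_prop)]
  rfl

theorem integral_transKernel {E : Type*} [NormedAddCommGroup E] [NormedSpace ℝ E] [CompleteSpace E]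
    {α : ℝ} (hα : α < 1 / 2) (x y : ℝ≥0) {f : ℝ≥0 → E} (hf : StronglyMeasurable f) :
    ∫ ξ, f ξ ∂transKernel α (x, y) = translation α y f x := by
  by_cases hx : x = 0
  · simp [translation, hx, transKernel_zero_left, integral_dirac' _ _ hf]
  by_cases hy : y = 0
  · simp [translation, hx, hy, transKernel_zero_right, integral_dirac' _ _ hf]
  have hm := ((measurable_kernelQ_mul_weight α).comp
    (measurable_prodMk_left (x := (x, y)))).ennreal_ofReal
  simp only [Function.comp_def] at hm
  rw [transKernel_of_ne_zero α hx hy, integral_map measurable_real_toNNReal.aemeasurable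
    hf.aestronglyMeasurable, integral_withDensity_eq_integral_toReal_smul hm
    (Filter.Eventually.of_forall fun _ => ENNReal.ofReal_lt_top), translation, if_neg hx, if_neg hy]
  refine setIntegral_congr_fun measurableSet_Ioi fun ξ hξ => ?_
  rw [ENNReal.toReal_ofReal (kernelQ_mul_weight_nonneg hα x.coe_nonneg y.coe_nonneg (le_of_lt hξ))]

/-- The Gamma law `t^{b-1} e^{-t} dt` on `(0, ∞)`, not normalized. -/
noncomputable def gammaLaw (b : ℝ) : Measure ℝ :=
  (volume.restrict (Ioi (0 : ℝ))).withDensity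
    (fun t => ENNReal.ofReal (t ^ (b - 1) * Real.exp (-t)))

theorem lintegral_gammaLaw (b : ℝ) {f : ℝ → ENNReal} (hf : Measurable f) :
    ∫⁻ t, f t ∂gammaLaw b =
      ∫⁻ t in Ioi (0 : ℝ), ENNReal.ofReal (t ^ (b - 1) * Real.exp (-t)) * f t := by
  rw [gammaLaw, lintegral_withDensity_eq_lintegral_mul _ (by fun_prop) hf]
  rfl

theorem gammaLaw_univ {b : ℝ} (hb : 0 < b) :
    gammaLaw b univ = ENNReal.ofReal (Real.Gamma b) := by
  have := lintegral_rpow_mul_exp_neg_mul hb one_pos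
  rw [← lintegral_one, lintegral_gammaLaw b measurable_const]
  simpa using this

theorem isFiniteMeasure_gammaLaw {b : ℝ} (hb : 0 < b) : IsFiniteMeasure (gammaLaw b) :=
  ⟨by rw [gammaLaw_univ hb]; exact ENNReal.ofReal_lt_top⟩

instance (b : ℝ) : SFinite (gammaLaw b) := by unfold gammaLaw; infer_instance

/-- The law identity `map_gammaLaw_eq` for `x, y > 0`, tested on nonnegative functions. -/
theorem lintegral_mul_sq_transKernel {α a : ℝ} (haα : a = 1 / 2 - α) (ha : 0 < a) {x y : ℝ≥0}
    (hx : x ≠ 0) (hy : y ≠ 0) {f : ℝ → ENNReal} (hf : Measurable f) :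
    ∫⁻ ξ, ∫⁻ t, f (t * ξ ^ 2) ∂gammaLaw (2 * a) ∂transKernel α (x, y) =
      ∫⁻ t, f (t * (x ^ 2 + y ^ 2 + 2 * (x * y) ^ 2 * t)) ∂gammaLaw (2 * a) := by
  have hx' : (0 : ℝ) < x := by positivity
  have hy' : (0 : ℝ) < y := by positivity
  set S : ℝ := (x : ℝ) ^ 2 + (y : ℝ) ^ 2 with hS
  have hS0 : 0 < S := by positivity
  set k : ℝ := x * y with hk
  have hk0 : 0 < k := by positivity
  have hqm := ((measurable_kernelQ_mul_weight α).comp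
    (measurable_prodMk_left (x := (x, y)))).ennreal_ofReal
  simp only [Function.comp_def] at hqm
  have hmain := fun t ht => lintegral_kernelQ_mul_weight (T := t) haα ha hx' hy' ht
  -- the density is made opaque, so that it is not unfolded in the computations below
  obtain ⟨Q, hQm, hQ⟩ : ∃ Q : ℝ → ENNReal, Measurable Q ∧
      ∀ ξ, ENNReal.ofReal (kernelQ α x y ξ * weight α ξ) = Q ξ := ⟨_, hqm, fun _ => rfl⟩
  simp only [hQ, ← hS, ← hk] at hmain
  rw [lintegral_transKernel hx hy (Measurable.lintegral_prod_right' (f := fun p : ℝ≥0 × ℝ =>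
      f (p.2 * p.1 ^ 2)) (by fun_prop)),
    lintegral_gammaLaw _ (by fun_prop)]
  simp only [hQ]
  -- substitute `w = t ξ²` in the inner integral
  have step1 : ∀ ξ ∈ Ioi (0 : ℝ), Q ξ *
      ∫⁻ t, f (t * (ξ.toNNReal : ℝ) ^ 2) ∂gammaLaw (2 * a) =
      ∫⁻ w in Ioi (0 : ℝ), ENNReal.ofReal (w ^ (2 * a - 1)) * f w *
        (Q ξ *
          ENNReal.ofReal (ξ ^ (-(4 * a)) * Real.exp (-(w / ξ ^ 2)))) := by
    intro ξ hξ
    have hξ' : (0 : ℝ) < ξ := hξ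
    rw [Real.coe_toNNReal _ hξ'.le, lintegral_gammaLaw _ (by fun_prop),
      lintegral_Ioi_comp_mul _ (show 0 < (ξ ^ 2)⁻¹ by positivity),
      ← lintegral_const_mul' _ _ ENNReal.ofReal_ne_top, ← lintegral_const_mul _ (by fun_prop)]
    refine setLIntegral_congr_fun measurableSet_Ioi fun w hw => ?_
    have hw' : (0 : ℝ) < w := hw
    have e0 : (ξ ^ 2)⁻¹ * w * ξ ^ 2 = w := by field_simp
    have e1 : (ξ ^ 2)⁻¹ * (((ξ ^ 2)⁻¹ * w) ^ (2 * a - 1) * Real.exp (-((ξ ^ 2)⁻¹ * w))) =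
        w ^ (2 * a - 1) * (ξ ^ (-(4 * a)) * Real.exp (-(w / ξ ^ 2))) := by
      have : (ξ ^ 2)⁻¹ * ((ξ ^ 2)⁻¹) ^ (2 * a - 1) = ξ ^ (-(4 * a)) := by
        rw [mul_comm, ← Real.rpow_add_one (by positivity), Real.inv_rpow (by positivity),
          ← Real.rpow_natCast, ← Real.rpow_mul hξ'.le, ← Real.rpow_neg hξ'.le]
        congr 1
        push_cast
        ring
      rw [Real.mul_rpow (by positivity) hw'.le, ← this, div_eq_inv_mul]
      ring
    rw [e0, ← mul_assoc (ENNReal.ofReal (ξ ^ 2)⁻¹), ← ENNReal.ofReal_mul (by positivity), e1,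
      ENNReal.ofReal_mul (by positivity)]
    ring
  rw [setLIntegral_congr_fun measurableSet_Ioi step1,
    lintegral_lintegral_swap (by fun_prop)]
  -- substitute `w = φ(t)` with `φ(t) = t (S + 2 k² t)`
  have himg : (fun t : ℝ => t * (S + 2 * k ^ 2 * t)) '' Ioi 0 = Ioi 0 := by
    ext w
    simp only [mem_image, mem_Ioi]
    refine ⟨by rintro ⟨t, ht, rfl⟩; positivity, fun hw => ?_⟩
    have hs : √(S ^ 2 + 8 * k ^ 2 * w) ^ 2 = S ^ 2 + 8 * k ^ 2 * w := Real.sq_sqrt (by positivity)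
    have hlt : S < √(S ^ 2 + 8 * k ^ 2 * w) :=
      Real.lt_sqrt_of_sq_lt (by nlinarith [mul_pos (pow_pos hk0 2) hw])
    refine ⟨(√(S ^ 2 + 8 * k ^ 2 * w) - S) / (4 * k ^ 2), div_pos (by linarith) (by positivity), ?_⟩
    field_simp
    linear_combination 2 * hs
  have hinj : InjOn (fun t : ℝ => t * (S + 2 * k ^ 2 * t)) (Ioi 0) := by
    refine StrictMonoOn.injOn fun u hu v hv huv => ?_
    have hu' : (0 : ℝ) < u := hu
    gcongr
  have hd : ∀ t ∈ Ioi (0 : ℝ), HasDerivWithinAt (fun t : ℝ => t * (S + 2 * k ^ 2 * t))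
      (S + 4 * k ^ 2 * t) (Ioi 0) t := by
    intro t _
    have := ((hasDerivAt_id t).mul (((hasDerivAt_id t).const_mul (2 * k ^ 2)).const_add S))
    refine (this.congr_deriv ?_).hasDerivWithinAt
    simp
    ring
  have h := lintegral_image_eq_lintegral_abs_deriv_mul (s := Ioi 0) measurableSet_Ioi hd hinj
    (fun w => ∫⁻ ξ in Ioi (0 : ℝ), ENNReal.ofReal (w ^ (2 * a - 1)) * f w *
        (Q ξ *
          ENNReal.ofReal (ξ ^ (-(4 * a)) * Real.exp (-(w / ξ ^ 2)))))
  rw [himg] at h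
  rw [h]
  refine setLIntegral_congr_fun measurableSet_Ioi fun t ht => ?_
  have ht' : (0 : ℝ) < t := ht
  rw [lintegral_const_mul _ (by fun_prop), hmain t ht',
    abs_of_pos (by positivity), ← mul_assoc, ← mul_assoc, mul_right_comm _ (f _),
    ← ENNReal.ofReal_mul (by positivity), ← ENNReal.ofReal_mul (by positivity)]
  congr 2
  rw [Real.mul_rpow ht'.le (by positivity), ← neg_sub (2 * a) 1,
    Real.rpow_neg (by positivity)]
  field_simp

/-- The case `f = 1` of `lintegral_mul_sq_transKernel` compares total masses. -/
theorem isMarkovKernel_transKernel {α : ℝ} (hα : α < 1 / 2) : IsMarkovKernel (transKernel α) := by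
  refine ⟨fun ⟨x, y⟩ => ?_⟩
  by_cases hx : x = 0
  · rw [hx, transKernel_zero_left]; infer_instance
  by_cases hy : y = 0
  · rw [hy, transKernel_zero_right]; infer_instance
  have h := lintegral_mul_sq_transKernel rfl (show 0 < 1 / 2 - α by linarith) hx hy
    (f := fun _ => 1) measurable_const
  have hb : 0 < 2 * (1 / 2 - α) := by linarith
  simp only [lintegral_const, gammaLaw_univ hb, one_mul] at h
  have hG : 0 < Real.Gamma (2 * (1 / 2 - α)) := Real.Gamma_pos_of_pos hb
  constructor
  exact (ENNReal.mul_eq_left (by simpa using hG) ENNReal.ofReal_ne_top).1 h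

/-- If `t` has a Gamma law of parameter `1 - 2α` and `ξ` is independent of `t` with law `δ_x * δ_y`,
then `t ξ²` and `t (x² + y² + 2 x² y² t)` have the same law. -/
theorem map_gammaLaw_eq {α a : ℝ} (haα : a = 1 / 2 - α) (ha : 0 < a) (x y : ℝ≥0) :
    ((gammaLaw (2 * a)).prod (transKernel α (x, y))).map (fun p => p.1 * (p.2 : ℝ) ^ 2) =
      (gammaLaw (2 * a)).map (fun t => t * ((x : ℝ) ^ 2 + (y : ℝ) ^ 2 + 2 * (x * y) ^ 2 * t)) := by
  have := isMarkovKernel_transKernel (α := α) (by linarith)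
  refine Measure.ext_of_lintegral _ fun f hf => ?_
  rw [lintegral_map hf (by fun_prop), lintegral_map hf (by fun_prop),
    lintegral_prod_symm _ (by fun_prop)]
  by_cases hx : x = 0
  · simp [hx, transKernel_zero_left]
  by_cases hy : y = 0
  · rw [hy, transKernel_zero_right, lintegral_dirac]
    simp
  exact lintegral_mul_sq_transKernel haα ha hx hy hf

/-! ### Confluent integrals and their products

All integrals over `(0, ∞)` are written in logarithmic variables, which turns complex powers into
exponentials of linear functions. -/

theorem exp_image_univ : Real.exp '' univ = Ioi 0 := by
  rw [image_univ, Real.range_exp]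

theorem integral_Ioi_eq_integral_exp {E : Type*} [NormedAddCommGroup E] [NormedSpace ℝ E]
    (f : ℝ → E) : ∫ t in Ioi (0 : ℝ), f t = ∫ θ, Real.exp θ • f (Real.exp θ) := by
  have h := integral_image_eq_integral_abs_deriv_smul (s := univ) MeasurableSet.univ
    (fun x _ => (Real.hasDerivAt_exp x).hasDerivWithinAt) Real.exp_injective.injOn f
  rw [exp_image_univ, Measure.restrict_univ] at h
  simpa using h

theorem integrableOn_Ioi_iff_integrable_exp {E : Type*} [NormedAddCommGroup E] [NormedSpace ℝ E]
    (f : ℝ → E) :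
    IntegrableOn f (Ioi 0) ↔ Integrable fun θ => Real.exp θ • f (Real.exp θ) := by
  have h := integrableOn_image_iff_integrableOn_abs_deriv_smul (s := univ) MeasurableSet.univ
    (fun x _ => (Real.hasDerivAt_exp x).hasDerivWithinAt) Real.exp_injective.injOn f
  rw [exp_image_univ] at h
  simpa using h

theorem lintegral_Ioi_eq_lintegral_exp (f : ℝ → ENNReal) :
    ∫⁻ t in Ioi (0 : ℝ), f t = ∫⁻ θ, ENNReal.ofReal (Real.exp θ) * f (Real.exp θ) := by
  have h := lintegral_image_eq_lintegral_abs_deriv_mul (s := univ) MeasurableSet.univ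
    (fun x _ => (Real.hasDerivAt_exp x).hasDerivWithinAt) Real.exp_injective.injOn f
  rw [exp_image_univ, Measure.restrict_univ] at h
  simpa using h

theorem ofReal_exp_cpow (θ : ℝ) (s : ℂ) : ((Real.exp θ : ℝ) : ℂ) ^ s = Complex.exp (s * θ) := by
  rw [Complex.cpow_def_of_ne_zero (by exact_mod_cast (Real.exp_pos θ).ne'), ← Complex.ofReal_log
    (Real.exp_pos θ).le, Real.log_exp, mul_comm]

theorem exp_smul_gamma_integrand (b : ℂ) (θ : ℝ) :
    Real.exp θ • ((Real.exp (-Real.exp θ) : ℂ) * ((Real.exp θ : ℝ) : ℂ) ^ (b - 1)) =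
      Complex.exp (b * θ - Real.exp θ) := by
  rw [ofReal_exp_cpow, Complex.real_smul]
  push_cast
  rw [← Complex.exp_add, ← Complex.exp_add]
  ring_nf

/-- Euler's integral for `Γ` in the logarithmic variable. -/
theorem integral_exp_mul_sub_exp {b : ℂ} (hb : 0 < b.re) :
    ∫ θ : ℝ, Complex.exp (b * θ - Real.exp θ) = Complex.Gamma b := by
  rw [Complex.Gamma_eq_integral hb, Complex.GammaIntegral, integral_Ioi_eq_integral_exp]
  simp_rw [exp_smul_gamma_integrand]

theorem integrable_exp_mul_sub_exp {b : ℂ} (hb : 0 < b.re) :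
    Integrable fun θ : ℝ => Complex.exp (b * θ - Real.exp θ) := by
  have h := (integrableOn_Ioi_iff_integrable_exp _).1 (Complex.GammaIntegral_convergent hb)
  simpa only [exp_smul_gamma_integrand] using h

/-- The integrand of the confluent integral `∫₀^∞ e^{-s} s^{a+ν-1} (1 + c s)^{ν-a} ds` in the
logarithmic variable `σ = log s`. -/
noncomputable def confluentIntegrand (a : ℝ) (ν : ℂ) (c σ : ℝ) : ℂ :=
  Complex.exp ((a + ν) * σ - Real.exp σ + (ν - a) * Real.log (1 + c * Real.exp σ))

/-- The confluent integral `∫₀^∞ e^{-s} s^{a+ν-1} (1 + c s)^{ν-a} ds`. It equals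
`Γ(a + ν) 𝑾_{α,ν}(x)` for `a = 1/2 - α` and `c = 2 x²`. -/
noncomputable def confluent (a : ℝ) (ν : ℂ) (c : ℝ) : ℂ := ∫ σ : ℝ, confluentIntegrand a ν c σ

/-- The symmetric double integrand
`e^{-u-v-cuv} u^{a+ν-1} v^{a-ν-1}` in the logarithmic variables `p = log u`, `q = log v`. -/
noncomputable def symIntegrand (a : ℝ) (ν : ℂ) (c : ℝ) (z : ℝ × ℝ) : ℂ :=
  Complex.exp ((a + ν) * z.1 + (a - ν) * z.2 -
    (Real.exp z.1 + Real.exp z.2 + c * (Real.exp z.1 * Real.exp z.2) : ℝ))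

theorem measurable_confluentIntegrand (a : ℝ) (ν : ℂ) :
    Measurable fun p : ℝ × ℝ => confluentIntegrand a ν p.1 p.2 := by
  unfold confluentIntegrand
  fun_prop

theorem measurable_confluent (a : ℝ) (ν : ℂ) : Measurable (confluent a ν) :=
  (StronglyMeasurable.integral_prod_right (f := fun c σ => confluentIntegrand a ν c σ)
    (measurable_confluentIntegrand a ν).stronglyMeasurable).measurable

theorem norm_confluentIntegrand_le {a : ℝ} {ν : ℂ} (h : ν.re ≤ a) {c : ℝ} (hc : 0 ≤ c) (σ : ℝ) :
    ‖confluentIntegrand a ν c σ‖ ≤ ‖Complex.exp ((a + ν) * σ - Real.exp σ)‖ := by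
  rw [confluentIntegrand, Complex.norm_exp, Complex.norm_exp]
  refine Real.exp_le_exp.2 ?_
  have : 0 ≤ Real.log (1 + c * Real.exp σ) := Real.log_nonneg (by
    have := mul_nonneg hc (Real.exp_pos σ).le
    linarith)
  simp only [Complex.add_re, Complex.re_mul_ofReal, Complex.sub_re, Complex.ofReal_re]
  nlinarith

theorem integrable_confluentIntegrand {a : ℝ} {ν : ℂ} (h : ν.re ≤ a) (h' : -a < ν.re) {c : ℝ}
    (hc : 0 ≤ c) : Integrable (confluentIntegrand a ν c) := by
  refine (integrable_exp_mul_sub_exp (b := a + ν) (by simp; linarith)).mono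
    ((measurable_confluentIntegrand a ν).comp measurable_prodMk_left).aestronglyMeasurable
    (Filter.Eventually.of_forall fun σ => norm_confluentIntegrand_le h hc σ)

theorem norm_confluent_le {a : ℝ} {ν : ℂ} (h : ν.re ≤ a) (h' : -a < ν.re) {c : ℝ}
    (hc : 0 ≤ c) :
    ‖confluent a ν c‖ ≤ ∫ σ : ℝ, ‖Complex.exp ((a + ν) * σ - Real.exp σ)‖ :=
  (norm_integral_le_integral_norm _).trans (integral_mono
    (integrable_confluentIntegrand h h' hc).norm
    (integrable_exp_mul_sub_exp (b := a + ν) (by simp; linarith)).norm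
    fun σ => norm_confluentIntegrand_le h hc σ)

theorem confluent_zero {a : ℝ} {ν : ℂ} (h : -a < ν.re) :
    confluent a ν 0 = Complex.Gamma (a + ν) := by
  rw [← integral_exp_mul_sub_exp (b := a + ν) (by simp; linarith)]
  simp [confluent, confluentIntegrand]

/-- For `ν = a` the confluent integral does not depend on `c`; this makes `𝑾_{α,a} = 1`. -/
theorem confluent_self {a : ℝ} (ha : 0 < a) (c : ℝ) :
    confluent a a c = Complex.Gamma (a + a) := by
  rw [← integral_exp_mul_sub_exp (b := a + a) (by simp; linarith)]
  simp [confluent, confluentIntegrand]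

theorem integrable_symIntegrand {a : ℝ} {ν : ℂ} (h : |ν.re| < a) {c : ℝ} (hc : 0 ≤ c) :
    Integrable (symIntegrand a ν c) := by
  have h1 := integrable_exp_mul_sub_exp (b := a + ν) (by simp; linarith [neg_lt_of_abs_lt h])
  have h2 := integrable_exp_mul_sub_exp (b := a - ν) (by simp; linarith [lt_of_abs_lt h])
  refine (h1.mul_prod h2).mono (by unfold symIntegrand; fun_prop)
    (Filter.Eventually.of_forall fun z => ?_)
  rw [symIntegrand, ← Complex.exp_add, Complex.norm_exp, Complex.norm_exp]
  refine Real.exp_le_exp.2 ?_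
  have : 0 ≤ c * (Real.exp z.1 * Real.exp z.2) := by positivity
  simp only [Complex.add_re, Complex.re_mul_ofReal, Complex.sub_re, Complex.ofReal_re]
  linarith

theorem integral_symIntegrand {a : ℝ} {ν : ℂ} (h : |ν.re| < a) {c : ℝ} (hc : 0 ≤ c) :
    ∫ z, symIntegrand a ν c z = Complex.Gamma (a - ν) * confluent a ν c := by
  rw [Measure.volume_eq_prod, integral_prod _ (integrable_symIntegrand h hc), confluent,
    ← integral_const_mul]
  refine integral_congr_ae (Filter.Eventually.of_forall fun p => ?_)
  have hpos : 0 < 1 + c * Real.exp p := by positivity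
  dsimp only
  -- translate `q` by `log (1 + c e^p)`
  rw [← integral_add_right_eq_self _ (-Real.log (1 + c * Real.exp p)),
    ← integral_exp_mul_sub_exp (b := a - ν) (by simp; linarith [lt_of_abs_lt h]),
    ← integral_mul_const]
  refine integral_congr_ae (Filter.Eventually.of_forall fun q => ?_)
  have e : Real.exp (q + -Real.log (1 + c * Real.exp p)) * (1 + c * Real.exp p) = Real.exp q := by
    rw [Real.exp_add, Real.exp_neg, Real.exp_log hpos]
    field_simp
  dsimp only
  rw [symIntegrand, confluentIntegrand, ← Complex.exp_add, ← e]
  congr 1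
  push_cast
  ring

/-- Up to Gamma factors, the confluent integral is even in `ν`. -/
theorem Gamma_mul_confluent_neg {a : ℝ} {ν : ℂ} (h : |ν.re| < a) {c : ℝ} (hc : 0 ≤ c) :
    Complex.Gamma (a + ν) * confluent a (-ν) c = Complex.Gamma (a - ν) * confluent a ν c := by
  have h' : |(-ν).re| < a := by simpa using h
  rw [← integral_symIntegrand h hc, ← sub_neg_eq_add, ← integral_symIntegrand h' hc,
    Measure.volume_eq_prod, ← integral_prod_swap]
  refine integral_congr_ae (Filter.Eventually.of_forall fun z => ?_)
  simp only [symIntegrand, Prod.fst_swap, Prod.snd_swap]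
  congr 1
  push_cast
  ring

/-- The integrand of the hypergeometric integral
`∫₀^∞ r^{a+ν-1} (1 + c r)^{ν-a} (1 + r)^{-ν-a} dr` in the logarithmic variable. -/
noncomputable def hyperIntegrand (a : ℝ) (ν : ℂ) (c r : ℝ) : ℂ :=
  Complex.exp ((a + ν) * r + (ν - a) * Real.log (1 + c * Real.exp r) -
    (ν + a) * Real.log (1 + Real.exp r))

/-- The hypergeometric integral `∫₀^∞ r^{a+ν-1} (1 + c r)^{ν-a} (1 + r)^{-ν-a} dr`, a multiple of
`₂F₁(a + ν, a - ν; 2a; 1 - c)`. -/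
noncomputable def hyper (a : ℝ) (ν : ℂ) (c : ℝ) : ℂ := ∫ r : ℝ, hyperIntegrand a ν c r

theorem measurable_hyper (a : ℝ) (ν : ℂ) : Measurable (hyper a ν) := by
  refine (StronglyMeasurable.integral_prod_right (f := fun c σ => hyperIntegrand a ν c σ)
    (Measurable.stronglyMeasurable ?_)).measurable
  unfold Function.uncurry hyperIntegrand
  fun_prop

theorem measurePreserving_shear {h : ℝ → ℝ} (hh : Measurable h) :
    MeasurePreserving (fun p : ℝ × ℝ => (p.1, p.2 + h p.1)) :=
  (MeasurePreserving.id volume).skew_product (g := fun x y => y + h x) (by fun_prop)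
    (Filter.Eventually.of_forall fun x => (measurePreserving_add_right volume (h x)).map_eq)

/-- In logarithmic coordinates, the substitution that turns a product of two confluent integrals
into an integral over a Gamma law: `t = s + s'` and `s / s' = (1 + d t) r`. -/
theorem measurePreserving_productSubst (d : ℝ) :
    MeasurePreserving (fun p : ℝ × ℝ =>
      (p.1 - Real.log (1 + Real.exp (p.2 + Real.log (1 + d * Real.exp p.1))) +
          (p.2 + Real.log (1 + d * Real.exp p.1)),
        p.1 - Real.log (1 + Real.exp (p.2 + Real.log (1 + d * Real.exp p.1))))) := by
  have hswap : MeasurePreserving (Prod.swap : ℝ × ℝ → ℝ × ℝ) := Measure.measurePreserving_swap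
  have h1 := measurePreserving_shear (h := fun θ => Real.log (1 + d * Real.exp θ)) (by fun_prop)
  have h2 := measurePreserving_shear (h := fun ρ => -Real.log (1 + Real.exp ρ)) (by fun_prop)
  have h3 := measurePreserving_shear (h := fun σ => σ) (by fun_prop)
  have := hswap.comp (h3.comp (hswap.comp (h2.comp (hswap.comp h1))))
  convert! this using 2 with p
  simp [sub_eq_add_neg, add_comm]

/-- The effect of `measurePreserving_productSubst` on the integrand of `K_ν(c) K_{-ν}(d)`, with
`t = e^θ`. -/
theorem confluentIntegrand_mul_productSubst {a : ℝ} {ν : ℂ} {c d : ℝ} (hc : 0 ≤ c) (hd : 0 ≤ d)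
    (θ r : ℝ) :
    confluentIntegrand a ν c (θ - Real.log (1 + Real.exp (r + Real.log (1 + d * Real.exp θ))) +
          (r + Real.log (1 + d * Real.exp θ))) *
      confluentIntegrand a (-ν) d
        (θ - Real.log (1 + Real.exp (r + Real.log (1 + d * Real.exp θ)))) =
    Complex.exp (2 * a * θ - Real.exp θ) *
      hyperIntegrand a ν ((1 + c * Real.exp θ) * (1 + d * Real.exp θ)) r := by
  set t := Real.exp θ with ht
  have ht0 : 0 < t := Real.exp_pos θ
  set D := 1 + d * t with hD
  have hD0 : 0 < D := by positivity
  set R := Real.exp r with hR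
  have hR0 : 0 < R := Real.exp_pos r
  have eρ : Real.exp (r + Real.log D) = D * R := by
    rw [Real.exp_add, Real.exp_log hD0, mul_comm]
  have hM : 0 < 1 + D * R := by positivity
  have e1 : Real.exp (θ - Real.log (1 + D * R)) = t / (1 + D * R) := by
    rw [Real.exp_sub, Real.exp_log hM]
  have e2 : Real.exp (θ - Real.log (1 + D * R) + (r + Real.log D)) = t / (1 + D * R) * (D * R) := by
    rw [Real.exp_add, e1, eρ]
  have l1 : Real.log (1 + c * (t / (1 + D * R) * (D * R))) =
      Real.log (1 + (1 + c * t) * D * R) - Real.log (1 + D * R) := by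
    rw [← Real.log_div (by positivity) (by positivity)]
    congr 1
    field_simp
    ring
  have l2 : Real.log (1 + d * (t / (1 + D * R))) =
      Real.log D + Real.log (1 + R) - Real.log (1 + D * R) := by
    rw [← Real.log_mul (by positivity) (by positivity), ← Real.log_div (by positivity)
      (by positivity)]
    congr 1
    rw [hD]
    field_simp
    ring
  have e3 : t / (1 + D * R) * (D * R) + t / (1 + D * R) = t := by field_simp; ring
  rw [confluentIntegrand, confluentIntegrand, hyperIntegrand, eρ, e2, e1, l1, l2,
    ← Complex.exp_add, ← Complex.exp_add]
  congr 1
  have e3' : (t : ℂ) = ((t / (1 + D * R) * (D * R) : ℝ) : ℂ) + ((t / (1 + D * R) : ℝ) : ℂ) := by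
    rw [← Complex.ofReal_add, e3]
  rw [e3', ← hR]
  push_cast
  ring

theorem gammaLaw_eq_map_exp (b : ℝ) : gammaLaw b =
    (volume.withDensity fun θ => ENNReal.ofReal (Real.exp (b * θ - Real.exp θ))).map Real.exp := by
  refine Measure.ext_of_lintegral _ fun f hf => ?_
  rw [lintegral_gammaLaw _ hf, lintegral_map hf Real.measurable_exp,
    lintegral_withDensity_eq_lintegral_mul _ (by fun_prop) (by fun_prop),
    lintegral_Ioi_eq_lintegral_exp]
  refine lintegral_congr fun θ => ?_
  rw [← mul_assoc, ← ENNReal.ofReal_mul (Real.exp_pos _).le, ← Real.exp_mul, ← Real.exp_add,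
    ← Real.exp_add, Pi.mul_apply]
  ring_nf

theorem integrable_gammaLaw_iff {b : ℝ} {f : ℝ → ℂ} (hf : Measurable f) :
    Integrable f (gammaLaw b) ↔
      Integrable fun θ : ℝ => Complex.exp (b * θ - Real.exp θ) * f (Real.exp θ) := by
  rw [gammaLaw_eq_map_exp, integrable_map_measure hf.aestronglyMeasurable
    Real.measurable_exp.aemeasurable, integrable_withDensity_iff_integrable_smul' (by fun_prop)
    (Filter.Eventually.of_forall fun _ => ENNReal.ofReal_lt_top)]
  refine integrable_congr (Filter.Eventually.of_forall fun θ => ?_)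
  simp [ENNReal.toReal_ofReal (Real.exp_pos _).le]

theorem integral_gammaLaw {b : ℝ} {f : ℝ → ℂ} (hf : Measurable f) :
    ∫ t, f t ∂gammaLaw b = ∫ θ : ℝ, Complex.exp (b * θ - Real.exp θ) * f (Real.exp θ) := by
  rw [gammaLaw_eq_map_exp, integral_map Real.measurable_exp.aemeasurable hf.aestronglyMeasurable,
    integral_withDensity_eq_integral_toReal_smul (by fun_prop)
    (Filter.Eventually.of_forall fun _ => ENNReal.ofReal_lt_top)]
  refine integral_congr_ae (Filter.Eventually.of_forall fun θ => ?_)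
  simp [ENNReal.toReal_ofReal (Real.exp_pos _).le]

/-- The product of two confluent integrals with opposite indices is an integral over a Gamma law, in
which `c` and `d` enter only through `(1 + c t) (1 + d t)`. -/
theorem confluent_mul_confluent {a : ℝ} {ν : ℂ} (h : |ν.re| < a) {c d : ℝ} (hc : 0 ≤ c)
    (hd : 0 ≤ d) :
    Integrable (fun t => hyper a ν ((1 + c * t) * (1 + d * t))) (gammaLaw (2 * a)) ∧
    ∫ t, hyper a ν ((1 + c * t) * (1 + d * t)) ∂gammaLaw (2 * a) =
      confluent a ν c * confluent a (-ν) d := by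
  have hlt := lt_of_abs_lt h
  have hgt := neg_lt_of_abs_lt h
  have i1 : Integrable (confluentIntegrand a ν c) :=
    integrable_confluentIntegrand hlt.le hgt hc
  have i2 : Integrable (confluentIntegrand a (-ν) d) :=
    integrable_confluentIntegrand (by simp; linarith) (by simpa using hlt) hd
  have hΦ := measurePreserving_productSubst d
  have hF := i1.mul_prod i2
  have hFΦ := hΦ.integrable_comp_of_integrable hF
  have hm : Measurable fun t => hyper a ν ((1 + c * t) * (1 + d * t)) :=
    (measurable_hyper a ν).comp (by fun_prop)
  simp only [Function.comp_def, confluentIntegrand_mul_productSubst hc hd] at hFΦ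
  have hinner : ∀ θ : ℝ, ∫ r : ℝ, Complex.exp (2 * a * θ - Real.exp θ) *
      hyperIntegrand a ν ((1 + c * Real.exp θ) * (1 + d * Real.exp θ)) r =
      Complex.exp ((2 * a : ℝ) * θ - Real.exp θ) *
        hyper a ν ((1 + c * Real.exp θ) * (1 + d * Real.exp θ)) := by
    intro θ
    rw [integral_const_mul, hyper]
    push_cast
    rfl
  constructor
  · rw [integrable_gammaLaw_iff hm]
    have := Integrable.integral_prod_left hFΦ
    simpa only [hinner] using this
  · rw [integral_gammaLaw hm]
    simp_rw [← hinner]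
    have h1 := integral_prod _ hFΦ
    have h2 := integral_map hΦ.measurable.aemeasurable
      (f := fun z : ℝ × ℝ => confluentIntegrand a ν c z.1 * confluentIntegrand a (-ν) d z.2)
      (by rw [hΦ.map_eq]; exact hF.aestronglyMeasurable)
    simp only [hΦ.map_eq, confluentIntegrand_mul_productSubst hc hd] at h2
    rw [← h1, confluent, confluent, ← integral_prod_mul]
    exact h2.symm

/-- The product formula for confluent integrals: `(1 + 2x²t) (1 + 2y²t)` is a function of
`t (x² + y² + 2x²y²t)`, which by `map_gammaLaw_eq` may be replaced by `t ξ²`. -/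
theorem integral_confluent_transKernel {α a : ℝ} (haα : a = 1 / 2 - α) {ν : ℂ} (h : |ν.re| < a)
    (x y : ℝ≥0) :
    Complex.Gamma (a - ν) * ∫ ξ, confluent a ν (2 * (ξ : ℝ) ^ 2) ∂transKernel α (x, y) =
      confluent a ν (2 * (x : ℝ) ^ 2) * confluent a (-ν) (2 * (y : ℝ) ^ 2) := by
  have ha : 0 < a := (abs_nonneg _).trans_lt h
  have := isMarkovKernel_transKernel (α := α) (by linarith)
  have hb : 0 < 2 * a := by linarith
  have := isFiniteMeasure_gammaLaw hb
  have hlaw := map_gammaLaw_eq haα ha x y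
  set G : ℝ → ℂ := fun w => hyper a ν (1 + 2 * w) with hG
  have hGm : Measurable G := (measurable_hyper a ν).comp (by fun_prop)
  obtain ⟨hi, he⟩ := confluent_mul_confluent h (c := 2 * (x : ℝ) ^ 2) (d := 2 * (y : ℝ) ^ 2)
    (by positivity) (by positivity)
  have hxy : ∀ t : ℝ, hyper a ν ((1 + 2 * (x : ℝ) ^ 2 * t) * (1 + 2 * (y : ℝ) ^ 2 * t)) =
      G (t * ((x : ℝ) ^ 2 + (y : ℝ) ^ 2 + 2 * (x * y) ^ 2 * t)) := by
    intro t
    simp only [hG]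
    congr 1
    ring
  simp only [hxy] at hi he
  rw [← he, ← integral_map (f := G)
    (φ := fun t : ℝ => t * ((x : ℝ) ^ 2 + (y : ℝ) ^ 2 + 2 * (x * y) ^ 2 * t)) (by fun_prop)
    hGm.aestronglyMeasurable, ← hlaw,
    integral_map (by fun_prop) hGm.aestronglyMeasurable]
  have hi' := (integrable_map_measure hGm.aestronglyMeasurable (by fun_prop)).2 hi
  rw [← hlaw] at hi'
  have hi2 := (integrable_map_measure hGm.aestronglyMeasurable (by fun_prop)).1 hi'
  simp only [Function.comp_def] at hi2
  rw [integral_prod_symm _ hi2, ← integral_const_mul]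
  refine integral_congr_ae (Filter.Eventually.of_forall fun ξ => ?_)
  -- `d = 0` recovers a single confluent integral
  have h2 := (confluent_mul_confluent h (c := 2 * (ξ : ℝ) ^ 2) (d := 0) (by positivity) le_rfl).2
  rw [confluent_zero (by simpa using lt_of_abs_lt h)] at h2
  dsimp only
  rw [mul_comm, sub_eq_add_neg, ← h2]
  refine integral_congr_ae (Filter.Eventually.of_forall fun t => ?_)
  simp only [hG]
  congr 1
  ring

/-! ### The normalized Whittaker functions -/

/-- The normalized Whittaker function as a confluent integral; `ν` is replaced by `-ν` when its
real part is negative. -/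
theorem boldW_eq_confluent_ite {α a : ℝ} (haα : a = 1 / 2 - α) (ha : 0 < a) (ν : ℂ) (x : ℝ≥0) :
    boldW α ν x = (Complex.Gamma (a + if 0 ≤ ν.re then ν else -ν))⁻¹ *
      confluent a (if 0 ≤ ν.re then ν else -ν) (2 * (x : ℝ) ^ 2) := by
  have hre : 0 ≤ (if 0 ≤ ν.re then ν else -ν).re := by
    split_ifs with h
    · exact h
    · simp only [Complex.neg_re]; linarith
  by_cases hx : x = 0
  · have : Complex.Gamma (a + if 0 ≤ ν.re then ν else -ν) ≠ 0 :=
      Complex.Gamma_ne_zero_of_re_pos (by simp only [Complex.add_re, Complex.ofReal_re]; linarith)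
    rw [boldW, if_pos hx, hx, NNReal.coe_zero, zero_pow two_ne_zero, mul_zero,
      confluent_zero (by linarith), inv_mul_cancel₀ this]
  have hx' : (0 : ℝ) < x := by positivity
  rw [boldW, if_neg hx]
  unfold whittakerW
  generalize (if 0 ≤ ν.re then ν else -ν) = μ
  dsimp only
  have hpar : (1 / 2 + μ - α : ℂ) = a + μ := by rw [haα]; push_cast; ring
  set z : ℝ := 1 / (2 * (x : ℝ) ^ 2) with hz
  have hz0 : 0 < z := by positivity
  -- substitute `t = s / z` in Tricomi's integral
  rw [tricomi, hpar, integral_Ioi_eq_integral_exp, ← integral_add_right_eq_self _ (-Real.log z),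
    confluent, ← mul_assoc, ← mul_assoc, mul_comm _ (Complex.Gamma (a + μ))⁻¹, mul_assoc,
    ← integral_const_mul]
  congr 1
  refine integral_congr_ae (Filter.Eventually.of_forall fun σ => ?_)
  have e1 : Real.exp (σ + -Real.log z) = Real.exp σ * (2 * (x : ℝ) ^ 2) := by
    rw [Real.exp_add, Real.exp_neg, Real.exp_log hz0, hz]
    field_simp
  have e2 : z * Real.exp (σ + -Real.log z) = Real.exp σ := by
    rw [e1, hz]
    field_simp
  have hlin : (2 : ℝ) ^ α * (x : ℝ) ^ (2 * α) = Real.exp (-α * Real.log z) := by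
    rw [hz, Real.log_div one_ne_zero (by positivity), Real.log_one, Real.log_mul two_ne_zero
      (by positivity), Real.log_pow, Real.rpow_def_of_pos two_pos, Real.rpow_def_of_pos hx',
      ← Real.exp_add]
    congr 1
    push_cast
    ring
  have hq : 1 / (4 * (x : ℝ) ^ 2) = z / 2 := by rw [hz]; field_simp; norm_num
  have hzc : ((z : ℝ) : ℂ) ^ (1 / 2 + μ) = Complex.exp ((1 / 2 + μ) * Real.log z) := by
    rw [← ofReal_exp_cpow, Real.exp_log hz0]
  have h1 : ((1 + Real.exp (σ + -Real.log z) : ℝ) : ℂ) ^ (1 + 2 * μ - (a + μ) - 1) =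
      Complex.exp ((μ - a) * Real.log (1 + 2 * (x : ℝ) ^ 2 * Real.exp σ)) := by
    have : 0 < 1 + 2 * (x : ℝ) ^ 2 * Real.exp σ := by positivity
    rw [e1, mul_comm (Real.exp σ), ← Real.exp_log this, ofReal_exp_cpow, Real.exp_log this]
    congr 1
    ring
  dsimp only
  rw [hq, hlin, h1, neg_mul z, e2, ofReal_exp_cpow, hzc, Complex.real_smul, confluentIntegrand]
  push_cast
  simp only [← Complex.exp_add]
  congr 1
  rw [haα]
  push_cast
  ring

theorem boldW_eq_confluent {α a : ℝ} (haα : a = 1 / 2 - α) {ν : ℂ} (h : |ν.re| < a) (x : ℝ≥0) :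
    boldW α ν x = (Complex.Gamma (a + ν))⁻¹ * confluent a ν (2 * (x : ℝ) ^ 2) := by
  have ha : 0 < a := (abs_nonneg _).trans_lt h
  rw [boldW_eq_confluent_ite haα ha]
  split_ifs with h0
  · rfl
  · have e := Gamma_mul_confluent_neg h (c := 2 * (x : ℝ) ^ 2) (by positivity)
    have h1 : Complex.Gamma (a + ν) ≠ 0 :=
      Complex.Gamma_ne_zero_of_re_pos (by simp; linarith [neg_lt_of_abs_lt h])
    have h2 : Complex.Gamma (a - ν) ≠ 0 :=
      Complex.Gamma_ne_zero_of_re_pos (by simp; linarith [lt_of_abs_lt h])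
    rw [← sub_eq_add_neg]
    field_simp
    linear_combination e

theorem boldW_half_sub {α a : ℝ} (haα : a = 1 / 2 - α) (ha : 0 < a) (x : ℝ≥0) :
    boldW α a x = 1 := by
  have hG : Complex.Gamma (a + a) ≠ 0 := Complex.Gamma_ne_zero_of_re_pos (by simp; linarith)
  rw [boldW_eq_confluent_ite haα ha]
  simp only [Complex.ofReal_re, ha.le, if_true]
  rw [confluent_self ha, inv_mul_cancel₀ hG]

theorem measurable_boldW {α a : ℝ} (haα : a = 1 / 2 - α) (ha : 0 < a) (ν : ℂ) :
    Measurable (boldW α ν) := by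
  have : boldW α ν = fun x : ℝ≥0 => _ := funext (boldW_eq_confluent_ite haα ha ν)
  rw [this]
  have := measurable_confluent a (if 0 ≤ ν.re then ν else -ν)
  fun_prop

theorem exists_norm_boldW_le {α a : ℝ} (haα : a = 1 / 2 - α) (ha : 0 < a) {ν : ℂ}
    (h : ν = a ∨ |ν.re| < a) : ∃ C, ∀ x, ‖boldW α ν x‖ ≤ C := by
  rcases h with rfl | h
  · exact ⟨1, fun x => by simp [boldW_half_sub haα ha]⟩
  · refine ⟨‖(Complex.Gamma (a + ν))⁻¹‖ * ∫ σ : ℝ, ‖Complex.exp ((a + ν) * σ - Real.exp σ)‖,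
      fun x => ?_⟩
    rw [boldW_eq_confluent haα h, norm_mul]
    exact mul_le_mul_of_nonneg_left (norm_confluent_le (lt_of_abs_lt h).le (neg_lt_of_abs_lt h)
      (by positivity)) (norm_nonneg _)

/-- The product formula for the normalized Whittaker functions. -/
theorem integral_boldW_transKernel {α a : ℝ} (haα : a = 1 / 2 - α) (ha : 0 < a) {ν : ℂ}
    (h : ν = a ∨ |ν.re| < a) (x y : ℝ≥0) :
    ∫ ξ, boldW α ν ξ ∂transKernel α (x, y) = boldW α ν x * boldW α ν y := by
  have := isMarkovKernel_transKernel (α := α) (by linarith)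
  rcases h with rfl | h
  · simp [boldW_half_sub haα ha]
  have h1 : Complex.Gamma (a + ν) ≠ 0 :=
    Complex.Gamma_ne_zero_of_re_pos (by simp; linarith [neg_lt_of_abs_lt h])
  have h2 : Complex.Gamma (a - ν) ≠ 0 :=
    Complex.Gamma_ne_zero_of_re_pos (by simp; linarith [lt_of_abs_lt h])
  have e := Gamma_mul_confluent_neg h (c := 2 * (y : ℝ) ^ 2) (by positivity)
  have p := integral_confluent_transKernel haα h x y
  simp_rw [boldW_eq_confluent haα h]
  rw [integral_const_mul]
  have e' : confluent a (-ν) (2 * (y : ℝ) ^ 2) = Complex.Gamma (a - ν) *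
      ((Complex.Gamma (a + ν))⁻¹ * confluent a ν (2 * (y : ℝ) ^ 2)) := by
    field_simp
    linear_combination e
  rw [e'] at p
  have p' : ∫ ξ, confluent a ν (2 * (ξ : ℝ) ^ 2) ∂transKernel α (x, y) =
      confluent a ν (2 * (x : ℝ) ^ 2) *
        ((Complex.Gamma (a + ν))⁻¹ * confluent a ν (2 * (y : ℝ) ^ 2)) := by
    refine mul_left_cancel₀ h2 ?_
    rw [p]
    ring
  rw [p']
  ring

theorem Delta_of_le {α l : ℝ} (h : l ≤ (1 / 2 - α) ^ 2) :
    Delta α l = (√((1 / 2 - α) ^ 2 - l) : ℝ) := by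
  rw [Delta, Real.sqrt_eq_rpow, Complex.ofReal_cpow (by linarith)]
  push_cast
  rfl

theorem Delta_add_sq (α τ : ℝ) : Delta α ((1 / 2 - α) ^ 2 + τ ^ 2) = |τ| * Complex.I := by
  rw [Delta, show (1 / 2 - α) ^ 2 - ((1 / 2 - α) ^ 2 + τ ^ 2) = -(|τ| ^ 2) by rw [sq_abs]; ring]
  have e1 : -((-(|τ| ^ 2) : ℝ) : ℂ) = ((|τ| ^ 2 : ℝ) : ℂ) := by push_cast; ring
  have e2 : ((|τ| ^ 2 : ℝ) : ℂ) ^ (1 / 2 : ℂ) = |τ| := by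
    have := Complex.ofReal_cpow (sq_nonneg |τ|) (1 / 2)
    rw [← Real.sqrt_eq_rpow, Real.sqrt_sq (abs_nonneg τ)] at this
    rw [this]
    push_cast
    rfl
  have e3 : Complex.exp (Real.pi * Complex.I * (1 / 2)) = Complex.I := by
    rw [show (Real.pi * Complex.I * (1 / 2) : ℂ) = Real.pi / 2 * Complex.I by ring,
      Complex.exp_mul_I, Complex.cos_pi_div_two, Complex.sin_pi_div_two]
    ring
  rw [Complex.ofReal_cpow_of_nonpos (by simp [sq_nonneg]), e1, e2, e3]

/-- The indices `Δ_λ`, `λ ≥ 0`, are those for which the product formula is available. -/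
theorem Delta_mem {α a l : ℝ} (haα : a = 1 / 2 - α) (ha : 0 < a) (hl : 0 ≤ l) :
    Delta α l = a ∨ |(Delta α l).re| < a := by
  rcases le_total l ((1 / 2 - α) ^ 2) with h | h
  · rw [Delta_of_le h, ← haα, Complex.ofReal_re, abs_of_nonneg (Real.sqrt_nonneg _)]
    rcases hl.eq_or_lt with rfl | hl
    · left
      rw [sub_zero, Real.sqrt_sq ha.le]
    · right
      rw [Real.sqrt_lt' ha]
      linarith
  · right
    obtain ⟨τ, hτ⟩ : ∃ τ : ℝ, τ ^ 2 = l - (1 / 2 - α) ^ 2 :=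
      ⟨√(l - (1 / 2 - α) ^ 2), Real.sq_sqrt (by linarith)⟩
    rw [show l = (1 / 2 - α) ^ 2 + τ ^ 2 by linarith, Delta_add_sq]
    simpa using ha

/-! ### Existence and uniqueness of the convolution of finite measures -/

theorem integral_bind_kernel {X Y E : Type*} [MeasurableSpace X] [MeasurableSpace Y]
    [NormedAddCommGroup E] [NormedSpace ℝ E] {μ : Measure X} {κ : Kernel X Y} {f : Y → E}
    (hf : Integrable f (μ.bind κ)) : ∫ y, f y ∂μ.bind κ = ∫ x, ∫ y, f y ∂κ x ∂μ := by
  rw [Measure.comp_eq_comp_const_apply] at hf ⊢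
  rw [Kernel.integral_comp hf, Kernel.const_apply]

/-- The convolution of two finite measures as a mixture of the measures `δ_x * δ_y`. -/
noncomputable def mixture (α : ℝ) (μ ν : Measure ℝ≥0) : Measure ℝ≥0 :=
  (μ.prod ν).bind (transKernel α)

theorem isFiniteMeasure_mixture {α : ℝ} (hα : α < 1 / 2) (μ ν : Measure ℝ≥0) [IsFiniteMeasure μ]
    [IsFiniteMeasure ν] : IsFiniteMeasure (mixture α μ ν) := by
  have := isMarkovKernel_transKernel hα
  unfold mixture
  infer_instance

theorem norm_integral_transKernel_le {E : Type*} [NormedAddCommGroup E] [NormedSpace ℝ E]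
    {α : ℝ} (hα : α < 1 / 2) {f : ℝ≥0 → E} {C : ℝ} (hC : ∀ x, ‖f x‖ ≤ C) (p : ℝ≥0 × ℝ≥0) :
    ‖∫ ξ, f ξ ∂transKernel α p‖ ≤ C := by
  have := isMarkovKernel_transKernel hα
  simpa using norm_integral_le_of_norm_le_const (μ := transKernel α p)
    (Filter.Eventually.of_forall hC)

theorem integral_mixture {E : Type*} [NormedAddCommGroup E] [NormedSpace ℝ E]
    {α : ℝ} (hα : α < 1 / 2) (μ ν : Measure ℝ≥0) [IsFiniteMeasure μ] [IsFiniteMeasure ν]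
    {f : ℝ≥0 → E} (hf : StronglyMeasurable f) {C : ℝ} (hC : ∀ x, ‖f x‖ ≤ C) :
    ∫ ξ, f ξ ∂mixture α μ ν = ∫ y, ∫ x, ∫ ξ, f ξ ∂transKernel α (x, y) ∂μ ∂ν := by
  have := isFiniteMeasure_mixture hα μ ν
  have hi : Integrable f (mixture α μ ν) :=
    Integrable.of_bound hf.aestronglyMeasurable C (Filter.Eventually.of_forall hC)
  have hi' : Integrable (fun p => ∫ ξ, f ξ ∂transKernel α p) (μ.prod ν) :=
    Integrable.of_bound (hf.integral_kernel (κ := transKernel α)).aestronglyMeasurable C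
      (Filter.Eventually.of_forall (norm_integral_transKernel_le hα hC))
  rw [mixture, integral_bind_kernel hi, integral_prod_symm _ hi']

theorem integral_translation_eq_mixture {E : Type*} [NormedAddCommGroup E] [NormedSpace ℝ E]
    [CompleteSpace E] [SecondCountableTopology E]
    {α : ℝ} (hα : α < 1 / 2) (μ ν : Measure ℝ≥0) [IsFiniteMeasure μ] [IsFiniteMeasure ν]
    (f : ℝ≥0 →ᵇ E) :
    ∫ ξ, f ξ ∂mixture α μ ν = ∫ y, ∫ x, translation α y f x ∂μ ∂ν := by
  have hf : StronglyMeasurable f := f.continuous.stronglyMeasurable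
  rw [integral_mixture hα μ ν hf f.norm_coe_le_norm]
  simp_rw [integral_transKernel hα _ _ hf]

theorem isConv_mixture {α : ℝ} (hα : α < 1 / 2) (μ ν : FiniteMeasure ℝ≥0) :
    IsConv α μ ν ⟨mixture α μ ν, isFiniteMeasure_mixture hα μ ν⟩ :=
  fun f => integral_translation_eq_mixture hα μ ν f

theorem IsConv.unique {α : ℝ} {μ ν ρ ρ' : FiniteMeasure ℝ≥0} (h : IsConv α μ ν ρ)
    (h' : IsConv α μ ν ρ') : ρ = ρ' :=
  FiniteMeasure.ext_of_forall_integral_eq fun f => (h f).trans (h' f).symm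

theorem isConv_conv {α : ℝ} (hα : α < 1 / 2) (μ ν : FiniteMeasure ℝ≥0) :
    IsConv α μ ν (conv α μ ν) := by
  have h : ∃ ρ, IsConv α μ ν ρ := ⟨_, isConv_mixture hα μ ν⟩
  rw [conv, dif_pos h]
  exact h.choose_spec

theorem coe_conv {α : ℝ} (hα : α < 1 / 2) (μ ν : FiniteMeasure ℝ≥0) :
    (conv α μ ν : Measure ℝ≥0) = mixture α μ ν := by
  rw [(isConv_conv hα μ ν).unique (isConv_mixture hα μ ν)]
  rfl

theorem eq_conv_iff {α : ℝ} (hα : α < 1 / 2) (μ ν ρ : FiniteMeasure ℝ≥0) :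
    ρ = conv α μ ν ↔ IsConv α μ ν ρ :=
  ⟨fun h => h ▸ isConv_conv hα μ ν, fun h => h.unique (isConv_conv hα μ ν)⟩

/-- The transform turns convolution into multiplication. -/
theorem transform_conv {α : ℝ} (hα : α < 1 / 2) (μ ν : FiniteMeasure ℝ≥0) {l : ℝ} (hl : 0 ≤ l) :
    transform α (conv α μ ν) l = transform α μ l * transform α ν l := by
  have ha : 0 < 1 / 2 - α := by linarith
  have h := Delta_mem (α := α) rfl ha hl
  obtain ⟨C, hC⟩ := exists_norm_boldW_le rfl ha h
  rw [transform, coe_conv hα,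
    integral_mixture hα _ _ (measurable_boldW rfl ha _).stronglyMeasurable hC]
  simp_rw [integral_boldW_transKernel rfl ha h, integral_mul_const]
  rw [integral_const_mul]
  rfl

/-! ### Injectivity of the transform -/

/-- A finite measure is determined by the moments of a bounded continuous injective function. -/
theorem ext_of_forall_integral_pow_eq {X : Type*} [PseudoEMetricSpace X] [MeasurableSpace X]
    [BorelSpace X] [CompleteSpace X] [SecondCountableTopology X] {P P' : Measure X}
    [IsFiniteMeasure P] [IsFiniteMeasure P'] (u : X →ᵇ ℝ) (hu : Function.Injective u)
    (h : ∀ n : ℕ, ∫ x, u x ^ n ∂P = ∫ x, u x ^ n ∂P') : P = P' := by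
  let A : StarSubalgebra ℝ (X →ᵇ ℝ) :=
    { (Polynomial.aeval (R := ℝ) u).range with
      star_mem' := fun {f} hf => by
        have : star f = f := by ext x; simp
        rw [this]
        exact hf }
  refine ext_of_forall_mem_subalgebra_integral_eq_of_pseudoEMetric_complete_countable
    (𝕜 := ℝ) (A := A) ?_ ?_
  · intro x y hxy
    refine ⟨u, ⟨u.toContinuousMap, ?_, rfl⟩, fun h => hxy (hu h)⟩
    exact ⟨u, ⟨Polynomial.X, by simp⟩, rfl⟩
  · rintro g ⟨p, rfl⟩
    have key : ∀ Q : Measure X, IsFiniteMeasure Q → ∫ x, (Polynomial.aeval u p : X →ᵇ ℝ) x ∂Q =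
        p.sum fun n c => c * ∫ x, u x ^ n ∂Q := by
      intro Q _
      have : ∀ x, (Polynomial.aeval u p : X →ᵇ ℝ) x = p.sum fun n c => c * u x ^ n := by
        intro x
        rw [Polynomial.aeval_eq_sum_range, Polynomial.sum_over_range _ (by simp)]
        simp
      simp_rw [this, Polynomial.sum]
      rw [integral_finsetSum _ fun n _ => (by
        simpa using ((u ^ n).integrable Q).const_mul (p.coeff n))]
      simp_rw [integral_const_mul]
    exact (key P ‹_›).trans ((by simp_rw [h]) : _ = _) |>.trans (key P' ‹_›).symm

/-- The Laplace transform `w ↦ ∫ e^{-2 w x²} μ(dx)` of the image of `μ` under `x ↦ 2 x²`. -/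
noncomputable def sqLaplace (μ : Measure ℝ≥0) (w : ℝ) : ℝ :=
  ∫ x, Real.exp (-(2 * (x : ℝ) ^ 2 * w)) ∂μ

theorem integrable_exp_neg_sq_mul (μ : Measure ℝ≥0) [IsFiniteMeasure μ] {w : ℝ} (hw : 0 ≤ w) :
    Integrable (fun x : ℝ≥0 => Real.exp (-(2 * (x : ℝ) ^ 2 * w))) μ := by
  refine Integrable.of_bound (by fun_prop) 1 (Filter.Eventually.of_forall fun x => ?_)
  rw [Real.norm_of_nonneg (Real.exp_pos _).le]
  exact Real.exp_le_one_iff.2 (by simp only [Left.neg_nonpos_iff]; positivity)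

/-- The values of `sqLaplace` at the natural numbers are the moments of `x ↦ e^{-2x²}`. The total
mass, its value at `0`, is a separate hypothesis. -/
theorem eq_of_sqLaplace_eq {μ ν : Measure ℝ≥0} [IsFiniteMeasure μ] [IsFiniteMeasure ν]
    (h0 : μ.real univ = ν.real univ) (h : ∀ w, 0 < w → sqLaplace μ w = sqLaplace ν w) : μ = ν := by
  let u : ℝ≥0 →ᵇ ℝ := BoundedContinuousFunction.ofNormedAddCommGroup
    (fun x : ℝ≥0 => Real.exp (-(2 * (x : ℝ) ^ 2))) (by fun_prop) 1 fun x => by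
      rw [Real.norm_of_nonneg (Real.exp_pos _).le]
      exact Real.exp_le_one_iff.2 (by simp only [Left.neg_nonpos_iff]; positivity)
  have hu : ∀ x : ℝ≥0, u x = Real.exp (-(2 * (x : ℝ) ^ 2)) := fun _ => rfl
  refine ext_of_forall_integral_pow_eq u (fun x y hxy => ?_) fun n => ?_
  · rw [hu, hu, Real.exp_eq_exp] at hxy
    have : (x : ℝ) ^ 2 = (y : ℝ) ^ 2 := by linarith
    exact NNReal.coe_injective ((pow_left_inj₀ x.2 y.2 two_ne_zero).1 this)
  · rcases Nat.eq_zero_or_pos n with rfl | hn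
    · simpa using h0
    · have key : ∀ x : ℝ≥0, u x ^ n = Real.exp (-(2 * (x : ℝ) ^ 2 * n)) := fun x => by
        rw [hu, ← Real.exp_nat_mul]
        ring_nf
      simp_rw [key]
      exact h n (by exact_mod_cast hn)

theorem continuous_sqLaplace_exp (μ : Measure ℝ≥0) [IsFiniteMeasure μ] :
    Continuous fun m : ℝ => sqLaplace μ (Real.exp m) := by
  refine continuous_of_dominated (bound := fun _ => 1) (fun m => by fun_prop)
    (fun m => Filter.Eventually.of_forall fun x => ?_) (integrable_const _)
    (Filter.Eventually.of_forall fun x => by fun_prop)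
  rw [Real.norm_of_nonneg (Real.exp_pos _).le]
  exact Real.exp_le_one_iff.2 (by simp only [Left.neg_nonpos_iff]; positivity)

theorem sqLaplace_nonneg (μ : Measure ℝ≥0) (w : ℝ) : 0 ≤ sqLaplace μ w :=
  integral_nonneg fun _ => (Real.exp_pos _).le

theorem sqLaplace_le (μ : Measure ℝ≥0) [IsFiniteMeasure μ] {w : ℝ} (hw : 0 ≤ w) :
    sqLaplace μ w ≤ μ.real univ := by
  have := integral_mono (integrable_exp_neg_sq_mul μ hw) (integrable_const (1 : ℝ)) fun x =>
    Real.exp_le_one_iff.2 (by simp only [Left.neg_nonpos_iff]; positivity)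
  simpa [sqLaplace] using this

/-- The integrand of `besselLaplace`. -/
noncomputable def besselLaplaceIntegrand (a : ℝ) (μ : Measure ℝ≥0) (k m : ℝ) : ℝ :=
  sqLaplace μ (Real.exp (2 * m)) * Real.exp (2 * a * m - k * Real.exp m)

/-- The Laplace transform at `k` of `L(r²) r^{2a-1} dr`, where `L = sqLaplace μ` and `r = e^m`. -/
noncomputable def besselLaplace (a : ℝ) (μ : Measure ℝ≥0) (k : ℝ) : ℝ :=
  ∫ m : ℝ, besselLaplaceIntegrand a μ k m

theorem continuous_besselLaplaceIntegrand (a : ℝ) (μ : Measure ℝ≥0) [IsFiniteMeasure μ] (k : ℝ) :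
    Continuous (besselLaplaceIntegrand a μ k) := by
  have := continuous_sqLaplace_exp μ
  unfold besselLaplaceIntegrand
  exact (this.comp (continuous_const_mul 2)).mul (by fun_prop)

theorem besselLaplaceIntegrand_nonneg (a : ℝ) (μ : Measure ℝ≥0) (k m : ℝ) :
    0 ≤ besselLaplaceIntegrand a μ k m :=
  mul_nonneg (sqLaplace_nonneg _ _) (Real.exp_pos _).le

theorem integrable_exp_two_mul_sub {a k : ℝ} (ha : 0 < a) (hk : 0 < k) :
    Integrable fun m : ℝ => Real.exp (2 * a * m - k * Real.exp m) := by
  have h := (integrable_exp_mul_sub_exp (b := (2 * a : ℝ)) (by simpa using ha)).norm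
  have h' := (h.comp_add_right (Real.log k)).const_mul (Real.exp (-(2 * a * Real.log k)))
  refine h'.congr (Filter.Eventually.of_forall fun m => ?_)
  dsimp only
  rw [Complex.norm_exp, ← Real.exp_add, Real.exp_add m, Real.exp_log hk]
  congr 1
  simp only [Complex.sub_re, Complex.re_mul_ofReal, Complex.ofReal_re]
  ring

theorem integrable_besselLaplaceIntegrand {a k : ℝ} (ha : 0 < a) (hk : 0 < k) (μ : Measure ℝ≥0)
    [IsFiniteMeasure μ] : Integrable (besselLaplaceIntegrand a μ k) := by
  refine ((integrable_exp_two_mul_sub ha hk).const_mul (μ.real univ)).mono'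
    (continuous_besselLaplaceIntegrand a μ k).aestronglyMeasurable
    (Filter.Eventually.of_forall fun m => ?_)
  rw [Real.norm_of_nonneg (besselLaplaceIntegrand_nonneg a μ k m)]
  exact mul_le_mul_of_nonneg_right (sqLaplace_le μ (Real.exp_pos _).le) (Real.exp_pos _).le

/-- Uniqueness for the Laplace transform `besselLaplace`: its values at `k = 2, 3, …` are the
moments of `e^{-r}` under the finite measure `e^{-2r} L(r²) r^{2a-1} dr`, and `L` is continuous. -/
theorem sqLaplace_eq_of_besselLaplace_eq {a : ℝ} (ha : 0 < a) {μ ν : Measure ℝ≥0}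
    [IsFiniteMeasure μ] [IsFiniteMeasure ν]
    (h : ∀ k, 2 ≤ k → besselLaplace a μ k = besselLaplace a ν k) {w : ℝ} (hw : 0 < w) :
    sqLaplace μ w = sqLaplace ν w := by
  let u : ℝ →ᵇ ℝ := BoundedContinuousFunction.ofNormedAddCommGroup
    (fun m : ℝ => Real.exp (-Real.exp m)) (by fun_prop) 1 fun m => by
      rw [Real.norm_of_nonneg (Real.exp_pos _).le]
      exact Real.exp_le_one_iff.2 (by simpa using (Real.exp_pos m).le)
  have hu : ∀ m : ℝ, u m = Real.exp (-Real.exp m) := fun _ => rfl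
  let D : Measure ℝ≥0 → Measure ℝ := fun ρ =>
    volume.withDensity fun m => ENNReal.ofReal (besselLaplaceIntegrand a ρ 2 m)
  have hfin : ∀ ρ : Measure ℝ≥0, IsFiniteMeasure ρ → IsFiniteMeasure (D ρ) := fun ρ _ =>
    isFiniteMeasure_withDensity_ofReal
      (integrable_besselLaplaceIntegrand ha two_pos ρ).hasFiniteIntegral
  have := hfin μ ‹_›
  have := hfin ν ‹_›
  have hmom : ∀ (ρ : Measure ℝ≥0) (_ : IsFiniteMeasure ρ) (n : ℕ),
      ∫ m, u m ^ n ∂D ρ = besselLaplace a ρ (2 + n) := by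
    intro ρ _ n
    rw [integral_withDensity_eq_integral_toReal_smul
      (continuous_besselLaplaceIntegrand a ρ 2).measurable.ennreal_ofReal
      (Filter.Eventually.of_forall fun _ => ENNReal.ofReal_lt_top), besselLaplace]
    refine integral_congr_ae (Filter.Eventually.of_forall fun m => ?_)
    dsimp only
    rw [ENNReal.toReal_ofReal (besselLaplaceIntegrand_nonneg _ _ _ _), hu, ← Real.exp_nat_mul,
      besselLaplaceIntegrand, besselLaplaceIntegrand, smul_eq_mul, mul_assoc, ← Real.exp_add]
    ring_nf
  have hD : D μ = D ν := ext_of_forall_integral_pow_eq u (fun x y hxy => by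
      rw [hu, hu] at hxy
      exact Real.exp_injective (neg_injective (Real.exp_injective hxy))) fun n => by
    rw [hmom μ ‹_›, hmom ν ‹_›, h _ (by linarith [n.cast_nonneg (α := ℝ)])]
  have hc := fun ρ [IsFiniteMeasure ρ] => continuous_besselLaplaceIntegrand a ρ 2
  have hae := (withDensity_eq_iff (hc μ).measurable.ennreal_ofReal.aemeasurable
    (hc ν).measurable.ennreal_ofReal.aemeasurable
    (by
      rw [← setLIntegral_univ, ← withDensity_apply _ MeasurableSet.univ]
      exact measure_ne_top (D μ) univ)).1 hD
  have heq := (Continuous.ae_eq_iff_eq volume (ENNReal.continuous_ofReal.comp (hc μ))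
    (ENNReal.continuous_ofReal.comp (hc ν))).1 hae
  have hm := congrFun heq (Real.log w / 2)
  simp only [Function.comp_apply] at hm
  rw [ENNReal.ofReal_eq_ofReal_iff (besselLaplaceIntegrand_nonneg _ _ _ _)
    (besselLaplaceIntegrand_nonneg _ _ _ _), besselLaplaceIntegrand, besselLaplaceIntegrand,
    mul_div_cancel₀ _ two_ne_zero, Real.exp_log hw] at hm
  exact mul_right_cancel₀ (Real.exp_pos _).ne' hm

theorem measurePreserving_sumDiff :
    MeasurePreserving (fun p : ℝ × ℝ => (p.2 + p.1 / 2, p.2 - p.1 / 2)) := by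
  have hswap : MeasurePreserving (Prod.swap : ℝ × ℝ → ℝ × ℝ) := Measure.measurePreserving_swap
  have h1 := measurePreserving_shear (h := fun d => -(d / 2)) (by fun_prop)
  have h2 := measurePreserving_shear (h := fun q => q) (by fun_prop)
  have := hswap.comp (h2.comp (hswap.comp h1))
  convert! this using 2 with p
  simp [sub_eq_add_neg]
  ring

/-- In the coordinates `m = (p + q) / 2`, `d = p - q`, the double integrand `symIntegrand` depends
on `ν` only through the factor `e^{ν d}`. -/
theorem symIntegrand_sumDiff (a : ℝ) (ν : ℂ) (c d m : ℝ) :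
    symIntegrand a ν c (m + d / 2, m - d / 2) = Complex.exp (ν * d) *
      ((Real.exp (-(c * Real.exp (2 * m))) *
        Real.exp (2 * a * m - 2 * Real.cosh (d / 2) * Real.exp m) : ℝ) : ℂ) := by
  have e1 : Real.exp (m + d / 2) + Real.exp (m - d / 2) =
      2 * Real.cosh (d / 2) * Real.exp m := by
    rw [Real.cosh_eq, sub_eq_add_neg, Real.exp_add, Real.exp_add]
    ring
  have e2 : Real.exp (m + d / 2) * Real.exp (m - d / 2) = Real.exp (2 * m) := by
    rw [← Real.exp_add]
    ring_nf
  rw [symIntegrand, e2, e1, ← Real.exp_add, Complex.ofReal_exp, ← Complex.exp_add]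
  congr 1
  push_cast
  ring

/-- The transform at `ν`, up to Gamma factors, is a Fourier–Laplace transform in `d`. -/
theorem Gamma_mul_integral_boldW {α a : ℝ} (haα : a = 1 / 2 - α) {ν : ℂ} (h : |ν.re| < a)
    (μ : Measure ℝ≥0) [IsFiniteMeasure μ] :
    Integrable (fun d : ℝ =>
      Complex.exp (ν * d) * (besselLaplace a μ (2 * Real.cosh (d / 2)) : ℂ)) ∧
    ∫ d : ℝ, Complex.exp (ν * d) * (besselLaplace a μ (2 * Real.cosh (d / 2)) : ℂ) =
      Complex.Gamma (a - ν) * Complex.Gamma (a + ν) * ∫ x, boldW α ν x ∂μ := by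
  have hG : Complex.Gamma (a + ν) ≠ 0 :=
    Complex.Gamma_ne_zero_of_re_pos (by simp; linarith [neg_lt_of_abs_lt h])
  set F : ℝ≥0 × (ℝ × ℝ) → ℂ := fun p =>
    symIntegrand a ν (2 * (p.1 : ℝ) ^ 2) (p.2.2 + p.2.1 / 2, p.2.2 - p.2.1 / 2) with hF
  have hFm : Measurable F := by
    simp only [hF, symIntegrand]
    fun_prop
  have h0 := measurePreserving_sumDiff.integrable_comp_of_integrable
    (integrable_symIntegrand h le_rfl)
  have hFi : Integrable F (μ.prod (volume.prod volume)) := by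
    refine ((integrable_const (1 : ℂ)).mul_prod h0).mono hFm.aestronglyMeasurable
      (Filter.Eventually.of_forall fun p => ?_)
    rw [one_mul, Function.comp_apply, symIntegrand_sumDiff]
    simp only [hF]
    rw [symIntegrand_sumDiff, norm_mul, norm_mul, Complex.norm_real, Complex.norm_real,
      Real.norm_of_nonneg (by positivity), Real.norm_of_nonneg (by positivity)]
    gcongr
    positivity
  have hx : ∀ z : ℝ × ℝ, ∫ x, F (x, z) ∂μ = Complex.exp (ν * z.1) *
      (besselLaplaceIntegrand a μ (2 * Real.cosh (z.1 / 2)) z.2 : ℂ) := by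
    intro z
    simp only [hF, symIntegrand_sumDiff]
    rw [integral_const_mul, integral_complex_ofReal, integral_mul_const]
    rfl
  have hin := hFi.integral_prod_right
  simp only [hx] at hin
  have hd : ∀ d : ℝ, ∫ m : ℝ, Complex.exp (ν * d) *
      (besselLaplaceIntegrand a μ (2 * Real.cosh (d / 2)) m : ℂ) =
      Complex.exp (ν * d) * (besselLaplace a μ (2 * Real.cosh (d / 2)) : ℂ) := by
    intro d
    rw [integral_const_mul, integral_complex_ofReal]
    rfl
  refine ⟨by simpa only [hd] using hin.integral_prod_left, ?_⟩
  calc _ = ∫ z, ∫ x, F (x, z) ∂μ ∂(volume.prod volume) := by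
        simp_rw [hx]
        rw [integral_prod _ hin]
        simp_rw [hd]
    _ = ∫ x, ∫ z, F (x, z) ∂(volume.prod volume) ∂μ := (integral_integral_swap hFi).symm
    _ = _ := by
        rw [← integral_const_mul]
        refine integral_congr_ae (Filter.Eventually.of_forall fun x => ?_)
        have hc : (0 : ℝ) ≤ 2 * (x : ℝ) ^ 2 := by positivity
        have hmp := integral_map measurePreserving_sumDiff.measurable.aemeasurable
          (f := symIntegrand a ν (2 * (x : ℝ) ^ 2))
          (by rw [measurePreserving_sumDiff.map_eq]
              exact (integrable_symIntegrand h hc).aestronglyMeasurable)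
        rw [measurePreserving_sumDiff.map_eq] at hmp
        dsimp only
        rw [boldW_eq_confluent haα h, mul_assoc, mul_inv_cancel_left₀ hG,
          ← integral_symIntegrand h hc, hmp]
        rfl

theorem continuous_besselLaplace_cosh {a : ℝ} (ha : 0 < a) (μ : Measure ℝ≥0) [IsFiniteMeasure μ] :
    Continuous fun d : ℝ => besselLaplace a μ (2 * Real.cosh (d / 2)) := by
  refine continuous_of_dominated (bound := besselLaplaceIntegrand a μ 2)
    (fun d => (continuous_besselLaplaceIntegrand a μ _).aestronglyMeasurable)
    (fun d => Filter.Eventually.of_forall fun m => ?_)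
    (integrable_besselLaplaceIntegrand ha two_pos μ)
    (Filter.Eventually.of_forall fun m => by unfold besselLaplaceIntegrand; fun_prop)
  rw [Real.norm_of_nonneg (besselLaplaceIntegrand_nonneg _ _ _ _)]
  refine mul_le_mul_of_nonneg_left (Real.exp_le_exp.2 ?_) (sqLaplace_nonneg _ _)
  nlinarith [Real.exp_pos m, Real.one_le_cosh (d / 2)]

theorem eq_of_fourier_eq {f g : ℝ → ℂ} (hf : Continuous f) (hg : Continuous g)
    (hfi : Integrable f) (hgi : Integrable g)
    (h : FourierTransform.fourier f = FourierTransform.fourier g) : f = g := by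
  have h0 : FourierTransform.fourier (f - g) = 0 := by
    funext w
    have hw := congrFun h w
    have i1 := (Real.fourierIntegral_convergent_iff w).2 hfi
    have i2 := (Real.fourierIntegral_convergent_iff w).2 hgi
    rw [Real.fourier_eq, Real.fourier_eq] at hw
    rw [Real.fourier_eq]
    simp_rw [Pi.sub_apply, smul_sub]
    rw [integral_sub i1 i2, hw, sub_self]
    rfl
  have hinv := Continuous.fourierInv_fourier_eq (hf.sub hg) (hfi.sub hgi) (by
    rw [h0]
    exact integrable_zero _ _ _)
  rw [h0] at hinv
  funext x
  have := congrFun hinv x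
  simp only [Real.fourierInv_eq, Pi.zero_apply, smul_zero, integral_zero] at this
  exact sub_eq_zero.1 this.symm

theorem boldW_neg {α a : ℝ} (haα : a = 1 / 2 - α) {ν : ℂ} (h : |ν.re| < a) (x : ℝ≥0) :
    boldW α (-ν) x = boldW α ν x := by
  have h' : |(-ν).re| < a := by simpa using h
  have h1 : Complex.Gamma (a + ν) ≠ 0 :=
    Complex.Gamma_ne_zero_of_re_pos (by simp; linarith [neg_lt_of_abs_lt h])
  have h2 : Complex.Gamma (a - ν) ≠ 0 :=
    Complex.Gamma_ne_zero_of_re_pos (by simp; linarith [lt_of_abs_lt h])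
  have e := Gamma_mul_confluent_neg h (c := 2 * (x : ℝ) ^ 2) (by positivity)
  rw [boldW_eq_confluent haα h, boldW_eq_confluent haα h', ← sub_eq_add_neg]
  field_simp
  linear_combination e

/-- For `λ = (1/2 - α)² + τ²` the index `Δ_λ` may be taken to be `iτ`. -/
theorem boldW_Delta_add_sq {α : ℝ} (hα : α < 1 / 2) (τ : ℝ) (x : ℝ≥0) :
    boldW α (Delta α ((1 / 2 - α) ^ 2 + τ ^ 2)) x = boldW α (τ * Complex.I) x := by
  rw [Delta_add_sq]
  rcases abs_choice τ with h | h
  · rw [h]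
  · rw [h, Complex.ofReal_neg, neg_mul, boldW_neg rfl (by simpa using hα)]

/-- A finite measure is determined by its index Whittaker transform. -/
theorem transform_injective {α : ℝ} (hα : α < 1 / 2) {μ ν : FiniteMeasure ℝ≥0}
    (h : ∀ l, 0 ≤ l → transform α μ l = transform α ν l) : μ = ν := by
  have ha : 0 < 1 / 2 - α := by linarith
  set a := 1 / 2 - α with haα
  set f : FiniteMeasure ℝ≥0 → ℝ → ℂ := fun ρ d =>
    (besselLaplace a (ρ : Measure ℝ≥0) (2 * Real.cosh (d / 2)) : ℂ) with hf
  have hfc : ∀ ρ, Continuous (f ρ) := fun ρ =>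
    Complex.continuous_ofReal.comp (continuous_besselLaplace_cosh ha _)
  have hfi : ∀ ρ, Integrable (f ρ) := fun ρ => by
    simpa using (Gamma_mul_integral_boldW haα (ν := 0) (by simpa using ha)
      (ρ : Measure ℝ≥0)).1
  have hft : ∀ ρ w, FourierTransform.fourier (f ρ) w =
      Complex.Gamma (a - (-(2 * Real.pi * w) : ℝ) * Complex.I) *
      Complex.Gamma (a + (-(2 * Real.pi * w) : ℝ) * Complex.I) *
        transform α ρ (a ^ 2 + (-(2 * Real.pi * w)) ^ 2) := by
    intro ρ w
    rw [transform]
    simp_rw [haα, boldW_Delta_add_sq hα]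
    rw [← haα, ← (Gamma_mul_integral_boldW haα (by simpa using ha) (ρ : Measure ℝ≥0)).2,
      Real.fourier_real_eq_integral_exp_smul]
    refine integral_congr_ae (Filter.Eventually.of_forall fun d => ?_)
    dsimp only
    rw [smul_eq_mul]
    congr 2
    push_cast
    ring
  have hff : f μ = f ν := eq_of_fourier_eq (hfc μ) (hfc ν) (hfi μ) (hfi ν) (by
    funext w
    rw [hft, hft, h _ (by positivity)])
  have hB : ∀ k, 2 ≤ k →
      besselLaplace a (μ : Measure ℝ≥0) k = besselLaplace a (ν : Measure ℝ≥0) k := by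
    intro k hk
    have := congrFun hff (2 * Real.arcosh (k / 2))
    simp only [hf] at this
    rw [mul_div_cancel_left₀ _ two_ne_zero, Real.cosh_arcosh (by linarith),
      mul_div_cancel₀ _ two_ne_zero] at this
    exact_mod_cast this
  refine FiniteMeasure.toMeasure_injective (eq_of_sqLaplace_eq ?_ fun w hw =>
    sqLaplace_eq_of_besselLaplace_eq ha hB hw)
  -- the transform at `0` is the total mass
  have h0 := h 0 le_rfl
  have hD : Delta α 0 = a := by
    rw [Delta_of_le (sq_nonneg _), sub_zero, Real.sqrt_sq ha.le]
  simp only [transform, hD, boldW_half_sub haα ha, integral_const] at h0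
  simpa using h0

/-! ### The algebra of finite measures -/

theorem eq_conv_iff_transform {α : ℝ} (hα : α < 1 / 2) (ρ μ ν : FiniteMeasure ℝ≥0) :
    ρ = conv α μ ν ↔
      ∀ l : ℝ, 0 ≤ l → transform α ρ l = transform α μ l * transform α ν l :=
  ⟨fun h l hl => by rw [h, transform_conv hα μ ν hl],
    fun h => transform_injective hα fun l hl => by rw [h l hl, transform_conv hα μ ν hl]⟩

theorem conv_comm {α : ℝ} (hα : α < 1 / 2) (μ ν : FiniteMeasure ℝ≥0) :
    conv α μ ν = conv α ν μ :=
  (eq_conv_iff_transform hα _ _ _).2 fun l hl => by rw [transform_conv hα _ _ hl, mul_comm]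

theorem conv_assoc {α : ℝ} (hα : α < 1 / 2) (μ ν ρ : FiniteMeasure ℝ≥0) :
    conv α (conv α μ ν) ρ = conv α μ (conv α ν ρ) :=
  (eq_conv_iff_transform hα _ _ _).2 fun l hl => by
    rw [transform_conv hα _ _ hl, transform_conv hα _ _ hl, transform_conv hα _ _ hl, mul_assoc]

/-! ### Integration against complex measures -/

/-- A finite measure regarded as a complex measure. -/
noncomputable def toComplex (μ : FiniteMeasure ℝ≥0) : ComplexMeasure ℝ≥0 :=
  (μ : Measure ℝ≥0).toSignedMeasure.toComplexMeasure 0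

theorem toComplex_apply (μ : FiniteMeasure ℝ≥0) {s : Set ℝ≥0} (hs : MeasurableSet s) :
    toComplex μ s = ((μ : Measure ℝ≥0).real s : ℂ) := by
  rw [toComplex, SignedMeasure.toComplexMeasure_apply,
    Measure.toSignedMeasure_apply_measurable hs]
  rfl

theorem variation_toComplex (μ : FiniteMeasure ℝ≥0) :
    (toComplex μ).variation = (μ : Measure ℝ≥0) := by
  have h : ∀ s, MeasurableSet s → ‖toComplex μ s‖ₑ = (μ : Measure ℝ≥0) s := fun s hs => by
    rw [toComplex_apply μ hs, ← ofReal_norm, Complex.norm_real,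
      Real.norm_of_nonneg measureReal_nonneg, ofReal_measureReal]
  refine le_antisymm (VectorMeasure.variation_le_of_forall_enorm_le fun s hs => (h s hs).le) ?_
  exact Measure.le_iff.2 fun s hs => (h s hs).symm.trans_le
    (VectorMeasure.enorm_measure_le_variation _ s)

/-- Every complex measure is a linear combination of finite measures (Jordan decomposition of the
real and imaginary parts). -/
theorem exists_eq_toComplex (μ : ComplexMeasure ℝ≥0) : ∃ a b c d : FiniteMeasure ℝ≥0,
    μ = toComplex a + (-1 : ℂ) • toComplex b + Complex.I • toComplex c
      + (-Complex.I) • toComplex d := by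
  let j := SignedMeasure.toJordanDecomposition (ComplexMeasure.re μ)
  let k := SignedMeasure.toJordanDecomposition (ComplexMeasure.im μ)
  have h1 : j.toSignedMeasure = ComplexMeasure.re μ :=
    SignedMeasure.toSignedMeasure_toJordanDecomposition _
  have h2 : k.toSignedMeasure = ComplexMeasure.im μ :=
    SignedMeasure.toSignedMeasure_toJordanDecomposition _
  let a : FiniteMeasure ℝ≥0 := ⟨j.posPart, inferInstance⟩
  let b : FiniteMeasure ℝ≥0 := ⟨j.negPart, inferInstance⟩
  let c : FiniteMeasure ℝ≥0 := ⟨k.posPart, inferInstance⟩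
  let d : FiniteMeasure ℝ≥0 := ⟨k.negPart, inferInstance⟩
  refine ⟨a, b, c, d, ?_⟩
  rw [← ComplexMeasure.toComplexMeasure_to_signedMeasure μ, ← h1, ← h2]
  refine VectorMeasure.ext fun s hs => ?_
  have hj : j.toSignedMeasure s = (a : Measure ℝ≥0).real s - (b : Measure ℝ≥0).real s :=
    Measure.toSignedMeasure_sub_apply hs
  have hk : k.toSignedMeasure s = (c : Measure ℝ≥0).real s - (d : Measure ℝ≥0).real s :=
    Measure.toSignedMeasure_sub_apply hs
  change (⟨j.toSignedMeasure s, k.toSignedMeasure s⟩ : ℂ) =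
    toComplex a s + -1 * toComplex b s + Complex.I * toComplex c s + -Complex.I * toComplex d s
  simp only [toComplex_apply _ hs, hj, hk]
  apply Complex.ext <;> simp [sub_eq_add_neg]

/-- A property of complex measures that is stable under linear combinations holds for all of them
once it holds for the finite positive ones. -/
theorem complexMeasure_induction {P : ComplexMeasure ℝ≥0 → Prop} (h : ∀ μ, P (toComplex μ))
    (hadd : ∀ μ ν, P μ → P ν → P (μ + ν)) (hsmul : ∀ (c : ℂ) μ, P μ → P (c • μ))
    (μ : ComplexMeasure ℝ≥0) : P μ := by
  obtain ⟨a, b, c, d, rfl⟩ := exists_eq_toComplex μ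
  exact hadd _ _ (hadd _ _ (hadd _ _ (h a) (hsmul _ _ (h b))) (hsmul _ _ (h c)))
    (hsmul _ _ (h d))

instance isFiniteMeasure_variation (μ : ComplexMeasure ℝ≥0) : IsFiniteMeasure μ.variation := by
  induction μ using complexMeasure_induction with
  | h μ => rw [variation_toComplex]; infer_instance
  | hadd μ ν hμ hν => exact isFiniteMeasure_of_le _ VectorMeasure.variation_add_le
  | hsmul c μ hμ => infer_instance

/-- Bounded measurable complex functions; these are integrable against every complex measure. -/
structure BoundedMeasurable (f : ℝ≥0 → ℂ) : Prop where
  measurable : Measurable f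
  bounded : ∃ C : ℝ, ∀ x, ‖f x‖ ≤ C

namespace BoundedMeasurable

theorem integrable {f : ℝ≥0 → ℂ} (hf : BoundedMeasurable f) (μ : Measure ℝ≥0)
    [IsFiniteMeasure μ] : Integrable f μ := by
  obtain ⟨C, hC⟩ := hf.bounded
  exact Integrable.of_bound hf.measurable.aestronglyMeasurable C (Filter.Eventually.of_forall hC)

theorem add {f g : ℝ≥0 → ℂ} (hf : BoundedMeasurable f) (hg : BoundedMeasurable g) :
    BoundedMeasurable (fun x => f x + g x) := by
  obtain ⟨C, hC⟩ := hf.bounded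
  obtain ⟨D, hD⟩ := hg.bounded
  exact ⟨hf.measurable.add hg.measurable, C + D,
    fun x => (norm_add_le _ _).trans (add_le_add (hC x) (hD x))⟩

theorem const_mul {f : ℝ≥0 → ℂ} (hf : BoundedMeasurable f) (c : ℂ) :
    BoundedMeasurable (fun x => c * f x) := by
  obtain ⟨C, hC⟩ := hf.bounded
  exact ⟨hf.measurable.const_mul c, ‖c‖ * C,
    fun x => (norm_mul _ _).trans_le (mul_le_mul_of_nonneg_left (hC x) (norm_nonneg c))⟩

end BoundedMeasurable

theorem boundedMeasurable_coe (f : ℝ≥0 →ᵇ ℂ) : BoundedMeasurable f :=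
  ⟨f.continuous.measurable, ‖f‖, f.norm_coe_le_norm⟩

/-- The dependence of `setToFun` on its reference measure is handled by generalizing over measures
equal to `(toComplex μ).variation`. -/
theorem cIntegral_toComplex (μ : FiniteMeasure ℝ≥0) (f : ℝ≥0 → ℂ) :
    cIntegral (toComplex μ) f = ∫ x, f x ∂(μ : Measure ℝ≥0) := by
  have key : ∀ (ν : Measure ℝ≥0) (C : ℝ), ν = (μ : Measure ℝ≥0) →
      ∀ h : DominatedFinMeasAdditive ν
        ((toComplex μ).transpose (ContinuousLinearMap.mul ℝ ℂ)) C,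
      setToFun ν _ h f = ∫ x, f x ∂(μ : Measure ℝ≥0) := by
    rintro _ C rfl h
    rw [MeasureTheory.integral_eq_setToFun]
    refine setToFun_congr_left' _ _ (fun s hs _ => ?_) _
    refine ContinuousLinearMap.ext fun x => ?_
    change x * toComplex μ s = ((μ : Measure ℝ≥0).real s) • x
    rw [toComplex_apply μ hs, mul_comm, Complex.real_smul]
  exact key _ _ (variation_toComplex μ) _

theorem setToFun_const_mul {ν : Measure ℝ≥0} {T T' : Set ℝ≥0 → ℂ →L[ℝ] ℂ} {C C' : ℝ}
    (h : DominatedFinMeasAdditive ν T C) (h' : DominatedFinMeasAdditive ν T' C') (c : ℂ)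
    (hT : ∀ s x, T s x = c * T' s x) {f : ℝ≥0 → ℂ} (hf : Integrable f ν) :
    setToFun ν T h f = c * setToFun ν T' h' f := by
  refine Integrable.induction (P := fun f => setToFun ν T h f = c * setToFun ν T' h' f)
    (fun x s hs hs' => ?_) (fun f g _ hf hg h1 h2 => ?_) ?_ (fun f g hfg _ h1 => ?_) hf
  · rw [setToFun_indicator_const h hs hs'.ne, setToFun_indicator_const h' hs hs'.ne, hT]
  · rw [setToFun_add h hf hg, setToFun_add h' hf hg, h1, h2, mul_add]
  · exact isClosed_eq (continuous_setToFun h) ((continuous_setToFun h').const_mul c)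
  · rw [← setToFun_congr_ae h hfg, ← setToFun_congr_ae h' hfg, h1]

theorem cIntegral_add_measure (μ ν : ComplexMeasure ℝ≥0) {f : ℝ≥0 → ℂ}
    (hf : BoundedMeasurable f) : cIntegral (μ + ν) f = cIntegral μ f + cIntegral ν f :=
  VectorMeasure.integral_add_vectorMeasure (hf.integrable _) (hf.integrable _)

/-- Real scalars are covered by the linearity of the vector-valued integral, and the factor `i`,
which does not change the variation, by `setToFun_const_mul`. -/
theorem cIntegral_smul_measure (c : ℂ) (μ : ComplexMeasure ℝ≥0) {f : ℝ≥0 → ℂ}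
    (hf : BoundedMeasurable f) : cIntegral (c • μ) f = c * cIntegral μ f := by
  have hv : (Complex.I • μ).variation = μ.variation := by
    simp [VectorMeasure.variation_smul]
  have key : ∀ (ν : Measure ℝ≥0) (C : ℝ), ν = μ.variation →
      ∀ h : DominatedFinMeasAdditive ν
        ((Complex.I • μ).transpose (ContinuousLinearMap.mul ℝ ℂ)) C,
      setToFun ν _ h f = Complex.I * cIntegral μ f := by
    rintro _ C rfl h
    refine setToFun_const_mul h _ Complex.I (fun s x => ?_) (hf.integrable _)
    change x * (Complex.I * μ s) = Complex.I * (x * μ s)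
    ring
  have hI : cIntegral (Complex.I • μ) f = Complex.I * cIntegral μ f := key _ _ hv _
  have hr : ∀ (r : ℝ) (ρ : ComplexMeasure ℝ≥0), cIntegral (r • ρ) f = r * cIntegral ρ f :=
    fun r ρ => (VectorMeasure.integral_smul_vectorMeasure f r).trans (Complex.real_smul)
  have hc : c • μ = c.re • μ + c.im • Complex.I • μ := by
    ext s -
    change c * μ s = c.re * μ s + c.im * (Complex.I * μ s)
    conv_lhs => rw [← Complex.re_add_im c]
    ring
  rw [hc, cIntegral_add_measure _ _ hf, hr, hr, hI]
  conv_rhs => rw [← Complex.re_add_im c]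
  ring

theorem cIntegral_add (μ : ComplexMeasure ℝ≥0) {f g : ℝ≥0 → ℂ} (hf : BoundedMeasurable f)
    (hg : BoundedMeasurable g) :
    cIntegral μ (fun x => f x + g x) = cIntegral μ f + cIntegral μ g :=
  VectorMeasure.integral_fun_add (hf.integrable _) (hg.integrable _)

theorem cIntegral_const_mul (μ : ComplexMeasure ℝ≥0) (c : ℂ) (f : ℝ≥0 → ℂ) :
    cIntegral μ (fun x => c * f x) = c * cIntegral μ f := by
  refine setToFun_smul _ (fun c s x => ?_) c f
  change c * x * μ s = c * (x * μ s)
  ring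

/-- Bounded continuous functions separate complex measures: testing the Jordan decomposition of the
difference on real functions reduces this to finite positive measures. -/
theorem eq_of_forall_cIntegral_eq {ρ ρ' : ComplexMeasure ℝ≥0}
    (h : ∀ f : ℝ≥0 →ᵇ ℂ, cIntegral ρ f = cIntegral ρ' f) : ρ = ρ' := by
  obtain ⟨a, b, c, d, hρ⟩ := exists_eq_toComplex (ρ + (-1 : ℂ) • ρ')
  have key : ∀ f : ℝ≥0 →ᵇ ℝ,
      (∫ x, f x ∂(a : Measure ℝ≥0) = ∫ x, f x ∂(b : Measure ℝ≥0)) ∧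
      (∫ x, f x ∂(c : Measure ℝ≥0) = ∫ x, f x ∂(d : Measure ℝ≥0)) := by
    intro f
    let g : ℝ≥0 →ᵇ ℂ := BoundedContinuousFunction.ofNormedAddCommGroup (fun x => (f x : ℂ))
      (Complex.continuous_ofReal.comp f.continuous) ‖f‖
      (fun x => (Complex.norm_real _).trans_le (f.norm_coe_le_norm x))
    have hg := boundedMeasurable_coe g
    have h0 : cIntegral (ρ + (-1 : ℂ) • ρ') g = 0 := by
      rw [cIntegral_add_measure _ _ hg, cIntegral_smul_measure _ _ hg, h g]
      ring
    have hi : ∀ μ : FiniteMeasure ℝ≥0,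
        cIntegral (toComplex μ) g = ((∫ x, f x ∂(μ : Measure ℝ≥0) : ℝ) : ℂ) := fun μ =>
      (cIntegral_toComplex μ g).trans integral_ofReal
    rw [hρ] at h0
    simp only [cIntegral_add_measure _ _ hg, cIntegral_smul_measure _ _ hg, hi] at h0
    have hre := congrArg Complex.re h0
    have him := congrArg Complex.im h0
    simp only [Complex.add_re, Complex.add_im, Complex.mul_re, Complex.mul_im, Complex.neg_re,
      Complex.neg_im, Complex.one_re, Complex.one_im, Complex.I_re, Complex.I_im,
      Complex.ofReal_re, Complex.ofReal_im, Complex.zero_re, Complex.zero_im] at hre him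
    constructor <;> linarith
  have hab : a = b := FiniteMeasure.ext_of_forall_integral_eq fun f => (key f).1
  have hcd : c = d := FiniteMeasure.ext_of_forall_integral_eq fun f => (key f).2
  have h0 : ρ + (-1 : ℂ) • ρ' = 0 := by
    rw [hρ, hab, hcd]
    module
  refine VectorMeasure.ext fun s _ => ?_
  have hs : ρ s + -1 * ρ' s = 0 := DFunLike.congr_fun h0 s
  linear_combination hs

/-! ### The convolution algebra of complex measures -/

theorem boundedMeasurable_translation {α : ℝ} (hα : α < 1 / 2) (f : ℝ≥0 →ᵇ ℂ) (y : ℝ≥0) :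
    BoundedMeasurable (fun x => translation α y f x) := by
  have hf : StronglyMeasurable f := f.continuous.stronglyMeasurable
  have h : StronglyMeasurable fun p => ∫ ξ, f ξ ∂transKernel α p :=
    hf.integral_kernel (κ := transKernel α)
  simp_rw [← integral_transKernel hα _ _ hf]
  exact ⟨h.measurable.comp measurable_prodMk_right, ‖f‖,
    fun x => norm_integral_transKernel_le hα f.norm_coe_le_norm _⟩

/-- The inner integral in the definition of the convolution is bounded and measurable, so that the
outer integral is not a junk value. -/
theorem boundedMeasurable_cIntegral_translation {α : ℝ} (hα : α < 1 / 2)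
    (μ : ComplexMeasure ℝ≥0) (f : ℝ≥0 →ᵇ ℂ) :
    BoundedMeasurable (fun y => cIntegral μ (fun x => translation α y f x)) := by
  have hT := boundedMeasurable_translation hα f
  induction μ using complexMeasure_induction with
  | h μ =>
    simp_rw [cIntegral_toComplex]
    have hf : StronglyMeasurable f := f.continuous.stronglyMeasurable
    have h : StronglyMeasurable fun p => ∫ ξ, f ξ ∂transKernel α p :=
      hf.integral_kernel (κ := transKernel α)
    simp_rw [← integral_transKernel hα _ _ hf]
    refine ⟨(h.integral_prod_left' (μ := (μ : Measure ℝ≥0))).measurable,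
      ‖f‖ * (μ : Measure ℝ≥0).real univ, fun y => ?_⟩
    exact norm_integral_le_of_norm_le_const (Filter.Eventually.of_forall
      fun x => norm_integral_transKernel_le hα f.norm_coe_le_norm _)
  | hadd μ ν hμ hν =>
    simp_rw [cIntegral_add_measure _ _ (hT _)]
    exact hμ.add hν
  | hsmul c μ hμ =>
    simp_rw [cIntegral_smul_measure _ _ (hT _)]
    exact hμ.const_mul c

section IsComplexConv

variable {α : ℝ} {μ μ' ν ν' ρ ρ' : ComplexMeasure ℝ≥0}

theorem isComplexConv_toComplex (hα : α < 1 / 2) (μ ν : FiniteMeasure ℝ≥0) :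
    IsComplexConv α (toComplex μ) (toComplex ν) (toComplex (conv α μ ν)) := by
  intro f
  simp_rw [cIntegral_toComplex]
  rw [coe_conv hα, integral_translation_eq_mixture hα]

theorem IsComplexConv.add_left (hα : α < 1 / 2) (h : IsComplexConv α μ ν ρ)
    (h' : IsComplexConv α μ' ν ρ') : IsComplexConv α (μ + μ') ν (ρ + ρ') := by
  intro f
  rw [cIntegral_add_measure _ _ (boundedMeasurable_coe f), h f, h' f]
  simp_rw [cIntegral_add_measure _ _ (boundedMeasurable_translation hα f _)]
  rw [cIntegral_add _ (boundedMeasurable_cIntegral_translation hα _ f)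
    (boundedMeasurable_cIntegral_translation hα _ f)]

theorem IsComplexConv.add_right (hα : α < 1 / 2) (h : IsComplexConv α μ ν ρ)
    (h' : IsComplexConv α μ ν' ρ') : IsComplexConv α μ (ν + ν') (ρ + ρ') := by
  intro f
  rw [cIntegral_add_measure _ _ (boundedMeasurable_coe f), h f, h' f,
    cIntegral_add_measure _ _ (boundedMeasurable_cIntegral_translation hα _ f)]

theorem IsComplexConv.smul_left (hα : α < 1 / 2) (c : ℂ) (h : IsComplexConv α μ ν ρ) :
    IsComplexConv α (c • μ) ν (c • ρ) := by
  intro f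
  rw [cIntegral_smul_measure _ _ (boundedMeasurable_coe f), h f]
  simp_rw [cIntegral_smul_measure _ _ (boundedMeasurable_translation hα f _)]
  rw [cIntegral_const_mul]

theorem IsComplexConv.smul_right (hα : α < 1 / 2) (c : ℂ) (h : IsComplexConv α μ ν ρ) :
    IsComplexConv α μ (c • ν) (c • ρ) := by
  intro f
  rw [cIntegral_smul_measure _ _ (boundedMeasurable_coe f), h f,
    cIntegral_smul_measure _ _ (boundedMeasurable_cIntegral_translation hα _ f)]

theorem exists_isComplexConv (hα : α < 1 / 2) (μ ν : ComplexMeasure ℝ≥0) :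
    ∃ ρ, IsComplexConv α μ ν ρ := by
  induction μ using complexMeasure_induction with
  | h μ =>
    induction ν using complexMeasure_induction with
    | h ν => exact ⟨_, isComplexConv_toComplex hα μ ν⟩
    | hadd ν ν' h h' => exact ⟨_, h.choose_spec.add_right hα h'.choose_spec⟩
    | hsmul c ν h => exact ⟨_, h.choose_spec.smul_right hα c⟩
  | hadd μ μ' h h' => exact ⟨_, h.choose_spec.add_left hα h'.choose_spec⟩
  | hsmul c μ h => exact ⟨_, h.choose_spec.smul_left hα c⟩

theorem isComplexConv_complexConv (hα : α < 1 / 2) (μ ν : ComplexMeasure ℝ≥0) :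
    IsComplexConv α μ ν (complexConv α μ ν) := by
  have h := exists_isComplexConv hα μ ν
  rw [complexConv, dif_pos h]
  exact h.choose_spec

theorem IsComplexConv.eq_complexConv (hα : α < 1 / 2) (h : IsComplexConv α μ ν ρ) :
    ρ = complexConv α μ ν :=
  eq_of_forall_cIntegral_eq fun f => (h f).trans (isComplexConv_complexConv hα μ ν f).symm

end IsComplexConv

theorem eq_complexConv_iff {α : ℝ} (hα : α < 1 / 2) (μ ν ρ : ComplexMeasure ℝ≥0) :
    ρ = complexConv α μ ν ↔ IsComplexConv α μ ν ρ :=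
  ⟨fun h => h ▸ isComplexConv_complexConv hα μ ν, fun h => h.eq_complexConv hα⟩

theorem complexConv_toComplex {α : ℝ} (hα : α < 1 / 2) (μ ν : FiniteMeasure ℝ≥0) :
    complexConv α (toComplex μ) (toComplex ν) = toComplex (conv α μ ν) :=
  ((isComplexConv_toComplex hα μ ν).eq_complexConv hα).symm

theorem complexConv_add_left {α : ℝ} (hα : α < 1 / 2) (μ μ' ν : ComplexMeasure ℝ≥0) :
    complexConv α (μ + μ') ν = complexConv α μ ν + complexConv α μ' ν :=
  (((isComplexConv_complexConv hα μ ν).add_left hα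
    (isComplexConv_complexConv hα μ' ν)).eq_complexConv hα).symm

theorem complexConv_add_right {α : ℝ} (hα : α < 1 / 2) (μ ν ν' : ComplexMeasure ℝ≥0) :
    complexConv α μ (ν + ν') = complexConv α μ ν + complexConv α μ ν' :=
  (((isComplexConv_complexConv hα μ ν).add_right hα
    (isComplexConv_complexConv hα μ ν')).eq_complexConv hα).symm

theorem complexConv_smul_left {α : ℝ} (hα : α < 1 / 2) (c : ℂ) (μ ν : ComplexMeasure ℝ≥0) :
    complexConv α (c • μ) ν = c • complexConv α μ ν :=
  (((isComplexConv_complexConv hα μ ν).smul_left hα c).eq_complexConv hα).symm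

theorem complexConv_smul_right {α : ℝ} (hα : α < 1 / 2) (c : ℂ) (μ ν : ComplexMeasure ℝ≥0) :
    complexConv α μ (c • ν) = c • complexConv α μ ν :=
  (((isComplexConv_complexConv hα μ ν).smul_right hα c).eq_complexConv hα).symm

theorem complexConv_comm {α : ℝ} (hα : α < 1 / 2) (μ ν : ComplexMeasure ℝ≥0) :
    complexConv α μ ν = complexConv α ν μ := by
  induction μ using complexMeasure_induction with
  | h μ =>
    induction ν using complexMeasure_induction with
    | h ν => rw [complexConv_toComplex hα, complexConv_toComplex hα, conv_comm hα]
    | hadd ν ν' h h' => rw [complexConv_add_left hα, complexConv_add_right hα, h, h']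
    | hsmul c ν h => rw [complexConv_smul_left hα, complexConv_smul_right hα, h]
  | hadd μ μ' h h' => rw [complexConv_add_left hα, complexConv_add_right hα, h, h']
  | hsmul c μ h => rw [complexConv_smul_left hα, complexConv_smul_right hα, h]

theorem complexConv_assoc {α : ℝ} (hα : α < 1 / 2) (μ ν ρ : ComplexMeasure ℝ≥0) :
    complexConv α (complexConv α μ ν) ρ = complexConv α μ (complexConv α ν ρ) := by
  induction μ using complexMeasure_induction with
  | h μ =>
    induction ν using complexMeasure_induction with
    | h ν =>
      induction ρ using complexMeasure_induction with
      | h ρ => simp only [complexConv_toComplex hα, conv_assoc hα]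
      | hadd ρ ρ' h h' => simp only [complexConv_add_right hα, h, h']
      | hsmul c ρ h => simp only [complexConv_smul_right hα, h]
    | hadd ν ν' h h' => simp only [complexConv_add_left hα, complexConv_add_right hα, h, h']
    | hsmul c ν h => simp only [complexConv_smul_left hα, complexConv_smul_right hα, h]
  | hadd μ μ' h h' => simp only [complexConv_add_left hα, h, h']
  | hsmul c μ h => simp only [complexConv_smul_left hα, h]

theorem cIntegral_complexDelta (f : ℝ≥0 → ℂ) : cIntegral complexDelta f = f 0 := by
  have h : cIntegral complexDelta f = f 0 * 1 := VectorMeasure.integral_dirac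
  rw [h, mul_one]

theorem complexConv_complexDelta_left {α : ℝ} (hα : α < 1 / 2) (μ : ComplexMeasure ℝ≥0) :
    complexConv α complexDelta μ = μ := by
  have h : IsComplexConv α complexDelta μ μ := fun f => by
    simp [cIntegral_complexDelta, translation]
  exact (h.eq_complexConv hα).symm

end IndexWhittaker

theorem mainTheorem5 (α : ℝ) (hα : α < 1 / 2) :
    -- the convolution of finite measures exists and is determined by its defining identity
    (∀ μ₁ μ₂ μ : FiniteMeasure ℝ≥0,
      μ = IndexWhittaker.conv α μ₁ μ₂ ↔ IndexWhittaker.IsConv α μ₁ μ₂ μ) ∧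
    -- connection between the transform and the convolution
    (∀ μ μ₁ μ₂ : FiniteMeasure ℝ≥0,
      μ = IndexWhittaker.conv α μ₁ μ₂ ↔
        ∀ l : ℝ, 0 ≤ l → IndexWhittaker.transform α μ l =
          IndexWhittaker.transform α μ₁ l * IndexWhittaker.transform α μ₂ l) ∧
    -- the convolution of finite measures is commutative and associative
    (∀ μ₁ μ₂ : FiniteMeasure ℝ≥0,
      IndexWhittaker.conv α μ₁ μ₂ = IndexWhittaker.conv α μ₂ μ₁) ∧
    (∀ μ₁ μ₂ μ₃ : FiniteMeasure ℝ≥0,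
      IndexWhittaker.conv α (IndexWhittaker.conv α μ₁ μ₂) μ₃ =
        IndexWhittaker.conv α μ₁ (IndexWhittaker.conv α μ₂ μ₃)) ∧
    -- the convolution of complex measures exists and is determined by its defining identity
    (∀ μ₁ μ₂ μ : ComplexMeasure ℝ≥0,
      μ = IndexWhittaker.complexConv α μ₁ μ₂ ↔ IndexWhittaker.IsComplexConv α μ₁ μ₂ μ) ∧
    -- it makes the space of complex measures a commutative associative algebra over `ℂ`
    (∀ μ₁ μ₂ μ₃ : ComplexMeasure ℝ≥0,
      IndexWhittaker.complexConv α (μ₁ + μ₂) μ₃ =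
        IndexWhittaker.complexConv α μ₁ μ₃ + IndexWhittaker.complexConv α μ₂ μ₃) ∧
    (∀ μ₁ μ₂ μ₃ : ComplexMeasure ℝ≥0,
      IndexWhittaker.complexConv α μ₁ (μ₂ + μ₃) =
        IndexWhittaker.complexConv α μ₁ μ₂ + IndexWhittaker.complexConv α μ₁ μ₃) ∧
    (∀ (c : ℂ) (μ₁ μ₂ : ComplexMeasure ℝ≥0),
      IndexWhittaker.complexConv α (c • μ₁) μ₂ = c • IndexWhittaker.complexConv α μ₁ μ₂ ∧
      IndexWhittaker.complexConv α μ₁ (c • μ₂) = c • IndexWhittaker.complexConv α μ₁ μ₂) ∧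
    (∀ μ₁ μ₂ : ComplexMeasure ℝ≥0,
      IndexWhittaker.complexConv α μ₁ μ₂ = IndexWhittaker.complexConv α μ₂ μ₁) ∧
    (∀ μ₁ μ₂ μ₃ : ComplexMeasure ℝ≥0,
      IndexWhittaker.complexConv α (IndexWhittaker.complexConv α μ₁ μ₂) μ₃ =
        IndexWhittaker.complexConv α μ₁ (IndexWhittaker.complexConv α μ₂ μ₃)) ∧
    -- with identity element `δ₀`
    (∀ μ : ComplexMeasure ℝ≥0,
      IndexWhittaker.complexConv α IndexWhittaker.complexDelta μ = μ ∧
      IndexWhittaker.complexConv α μ IndexWhittaker.complexDelta = μ) := by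
  open IndexWhittaker in
  exact ⟨fun μ₁ μ₂ μ => eq_conv_iff hα μ₁ μ₂ μ,
    fun μ μ₁ μ₂ => eq_conv_iff_transform hα μ μ₁ μ₂,
    conv_comm hα,
    conv_assoc hα,
    eq_complexConv_iff hα,
    complexConv_add_left hα,
    complexConv_add_right hα,
    fun c μ₁ μ₂ => ⟨complexConv_smul_left hα c μ₁ μ₂, complexConv_smul_right hα c μ₁ μ₂⟩,
    complexConv_comm hα,
    complexConv_assoc hα,
    fun μ => ⟨complexConv_complexDelta_left hα μ,
      (complexConv_comm hα _ _).trans (complexConv_complexDelta_left hα μ)⟩⟩
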